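/- Let $n\ge 2$. Let $\Xi=\{\xi\in\mathbb R^{n+2}\setminus\{0\}:\xi_0^2+\dots+\xi_n^2=\xi_{n+1}^2\}$, and for $\lambda\in\mathbb C$ let $I(\lambda)$ be the space of smooth functions $h$ on $\Xi$ with $h(t\xi)=|t|^{-\lambda}h(\xi)$ for $t\in\mathbb R^\times$ (the spherical principal series of $G=O(n+1,1)$). Let $J(\nu)$ be the analogous space for $G'=O(n,1)$, on the cone $\Xi'=\Xi\cap\{\xi_n=0\}$. Let $\mathbf 1_\lambda\in I(\lambda)$ and $\mathbf 1_\nu\in J(\nu)$ be the normalized spherical vectors, i.e. the vectors equal to $1$ on the sphere $\xi_{n+1}=1$. Restricting $h$ along $(x,x_n)\mapsto(1-|x|^2-x_n^2,\,2x,\,2x_n,\,1+|x|^2+x_n^2)$, $(x,x_n)\in\mathbb R^{n-1}\oplus\mathbb R$, one regards vectors of $I(\lambda)$ as functions on $\mathbb R^n$; setting $x_n=0$, one likewise regards vectors of $J(\nu)$ as functions on $\mathbb R^{n-1}$ (so $\mathbf 1_\lambda=(1+|x|^2+x_n^2)^{-\lambda}$ and $\mathbf 1_\nu=(1+|x|^2)^{-\nu}$).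 Consider the following symmetry breaking operators $I(\lambda)\to J(\nu)$. * For $(\lambda,\nu)\in\mathbb C^2$, $\widetilde{\mathbb A}_{\lambda,\nu}$ is given by $F\mapsto\int_{\mathbb R^n}\widetilde K(x-y,y_n)F(y,y_n)\,dy\,dy_n$ with $$\widetilde K(x,x_n)=\frac{|x_n|^{\lambda+\nu-n}(|x|^2+x_n^2)^{-\nu}}{\Gamma(\frac{\lambda+\nu-n+1}{2})\,\Gamma(\frac{\lambda-\nu}{2})}$$ when $\operatorname{Re}(\lambda-\nu)>0$ and $\operatorname{Re}(\lambda+\nu)>n-1$, and by holomorphic continuation to all $(\lambda,\nu)\in\mathbb C^2$ in general. * For $\lambda+\nu=n-1-2k$ with $k\in\mathbb N=\{0,1,2,\dots\}$, $\widetilde{\mathbb B}_{\lambda,\nu}$ is the operator with distribution kernel $\frac{1}{\Gamma(\frac{\lambda-\nu}{2})}(|x|^2+x_n^2)^{-\nu}\delta^{(2k)}(x_n)$, extended to the conformal compactification $S^n$ of $\mathbb R^n$ by homogeneity on the cone, when $\operatorname{Re}(\lambda-\nu)>0$; it is defined by holomorphic continuation along the line $\lambda+\nu=n-1-2k$ in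 general. * For $\nu-\lambda=2l$ with $l\in\mathbb N$, $$\widetilde{\mathbb C}_{\lambda,\nu}F=\Bigl(\sum_{j=0}^{l}\frac{2^{2l-2j}}{j!\,(2l-2j)!}\prod_{i=1}^{l-j}\Bigl(\frac{\lambda+\nu-n-1}{2}+i\Bigr)\,\Delta_{\mathbb R^{n-1}}^{j}\Bigl(\frac{\partial}{\partial x_n}\Bigr)^{2l-2j}F\Bigr)\Big|_{x_n=0}.$$ In the holomorphic continuations, the spaces $I(\lambda)$ for different $\lambda$ (and $J(\nu)$ for different $\nu$) are identified by restriction to the sphere $\xi_{n+1}=1$. Then, with $1/\Gamma$ the entire function (zero at $0,-1,-2,\dots$), $(\lambda)_{j}=\lambda(\lambda+1)\cdots(\lambda+j-1)$ and $(-1)!!=1$: 1. For all $(\lambda,\nu)\in\mathbb C^2$, $$\widetilde{\mathbb A}_{\lambda,\nu}(\mathbf 1_\lambda)=\frac{\pi^{\frac{n-1}{2}}}{\Gamma(\lambda)}\,\mathbf 1_\nu.$$ 2. For all $(\lambda,\nu)\in\mathbb C^2$ with $k:=\frac12(n-1-\lambda-\nu)\in\mathbb N$, $$\widetilde{\mathbb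 B}_{\lambda,\nu}(\mathbf 1_\lambda)=\frac{(-1)^k2^k\pi^{\frac{n-1}{2}}(2k-1)!!}{\Gamma(\lambda)}\,\mathbf 1_\nu.$$ 3. For all $(\lambda,\nu)\in\mathbb C^2$ with $l:=\frac12(\nu-\lambda)\in\mathbb N$, $$\widetilde{\mathbb C}_{\lambda,\nu}(\mathbf 1_\lambda)=\frac{(-1)^l2^{2l}(\lambda)_{2l}}{l!}\,\mathbf 1_\nu.$$ -/

import Mathlib

open MeasureTheory Set Topology
open scoped ContDiff InnerProductSpace

noncomputable section

namespace SymmetryBreaking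

/-- The Euclidean space of dimension `n`. -/
abbrev E (n : ℕ) : Type := EuclideanSpace ℝ (Fin n)

/-- The isotropic cone of the quadratic form `ξ₀² + ⋯ + ξₙ² - ξₙ₊₁²`, without the origin.
A point is written as a pair `((ξ₀, …, ξₙ), ξₙ₊₁)`; the vertex is excluded by `ξₙ₊₁ ≠ 0`, which on
the cone is the same as `ξ ≠ 0`. -/
def Cone (n : ℕ) : Type := {p : E (n + 1) × ℝ // ‖p.1‖ ^ 2 = p.2 ^ 2 ∧ p.2 ≠ 0}

/-- Dilation by a nonzero real number on the cone. -/
def Cone.dilate {n : ℕ} (t : ℝ) (ht : t ≠ 0) (ξ : Cone n) : Cone n :=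
  ⟨(t • ξ.1.1, t * ξ.1.2), by
    constructor
    · have h := ξ.2.1
      simp only [norm_smul, mul_pow, Real.norm_eq_abs, sq_abs, h]
    · exact mul_ne_zero ht ξ.2.2⟩

/-- Smooth functions on the cone: locally restrictions of smooth functions of the ambient space. -/
def SmoothOnCone {n : ℕ} (h : Cone n → ℂ) : Prop :=
  ∀ ξ : Cone n, ∃ U : Set (E (n + 1) × ℝ), IsOpen U ∧ ξ.1 ∈ U ∧
    ∃ g : E (n + 1) × ℝ → ℂ, ContDiffOn ℝ ∞ g U ∧ ∀ ζ : Cone n, ζ.1 ∈ U → h ζ = g ζ.1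

/-- The representation space `I(λ)` of the spherical principal series of `O(n+1,1)`: the smooth
functions on the isotropic cone with `h (t ξ) = |t| ^ (-λ) h (ξ)` for all real `t ≠ 0`.
The space `J(ν)` for the subgroup `O(n,1)` is `PS (n - 1) ν`. -/
def PS (n : ℕ) (lam : ℂ) : Submodule ℂ (Cone n → ℂ) where
  carrier := {h | SmoothOnCone h ∧
    ∀ (t : ℝ) (ht : t ≠ 0) (ξ : Cone n), h (ξ.dilate t ht) = ((|t| : ℝ) : ℂ) ^ (-lam) * h ξ}
  zero_mem' := by
    refine ⟨fun ξ => ⟨univ, isOpen_univ, mem_univ _, fun _ => 0, contDiffOn_const, ?_⟩, ?_⟩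
    · intro ζ _
      rfl
    · intro t ht ξ
      simp
  add_mem' := by
    rintro a b ⟨ha, ha2⟩ ⟨hb, hb2⟩
    refine ⟨fun ξ => ?_, ?_⟩
    · obtain ⟨U, hU, hξU, f, hf, hfa⟩ := ha ξ
      obtain ⟨V, hV, hξV, g, hg, hgb⟩ := hb ξ
      refine ⟨U ∩ V, hU.inter hV, ⟨hξU, hξV⟩, fun p => f p + g p,
        (hf.mono inter_subset_left).add (hg.mono inter_subset_right), ?_⟩
      intro ζ hζ
      simp [hfa ζ hζ.1, hgb ζ hζ.2]
    · intro t ht ξ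
      simp only [Pi.add_apply, ha2 t ht ξ, hb2 t ht ξ]
      ring
  smul_mem' := by
    rintro c a ⟨ha, ha2⟩
    refine ⟨fun ξ => ?_, ?_⟩
    · obtain ⟨U, hU, hξU, f, hf, hfa⟩ := ha ξ
      refine ⟨U, hU, hξU, fun p => c * f p, contDiffOn_const.mul hf, ?_⟩
      intro ζ hζ
      simp [hfa ζ hζ]
    · intro t ht ξ
      simp only [Pi.smul_apply, ha2 t ht ξ, smul_eq_mul]
      ring

theorem contDiffOn_abs_cpow (n : ℕ) (c : ℂ) :
    ContDiffOn ℝ ∞ (fun p : E (n + 1) × ℝ => ((|p.2| : ℝ) : ℂ) ^ c) {p | p.2 ≠ 0} := by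
  have h1 : ContDiffOn ℝ ∞ (fun p : E (n + 1) × ℝ => Real.log p.2) {p | p.2 ≠ 0} :=
    contDiff_snd.contDiffOn.log (fun p hp => hp)
  have h2 : ContDiffOn ℝ ∞ (fun p : E (n + 1) × ℝ => Complex.exp ((Real.log p.2 : ℂ) * c))
      {p | p.2 ≠ 0} :=
    ((Complex.ofRealCLM.contDiff.comp_contDiffOn h1).mul contDiffOn_const).cexp
  refine h2.congr ?_
  intro p hp
  have hp' : ((|p.2| : ℝ) : ℂ) ≠ 0 := by
    exact_mod_cast abs_ne_zero.mpr hp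
  rw [Complex.cpow_def_of_ne_zero hp', ← Complex.ofReal_log (abs_nonneg _), Real.log_abs]

/-- The vector of `I(λ')` that has the same restriction to the sphere `ξₙ₊₁ = 1` as the vector `h`
of `I(λ)`. All the spaces `I(λ)` are identified in this way (the compact picture), and holomorphic
dependence on the parameters is understood in this identification. -/
def transport {n : ℕ} {lam : ℂ} (lam' : ℂ) (h : PS n lam) : PS n lam' :=
  ⟨fun ξ => ((|ξ.1.2| : ℝ) : ℂ) ^ (lam - lam') * h.1 ξ, by
    obtain ⟨h, hs, hh⟩ := h
    refine ⟨fun ξ => ?_, ?_⟩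
    · obtain ⟨U, hU, hξU, f, hf, hfa⟩ := hs ξ
      refine ⟨U ∩ {p | p.2 ≠ 0}, hU.inter (isOpen_ne_fun continuous_snd continuous_const),
        ⟨hξU, ξ.2.2⟩, fun p => ((|p.2| : ℝ) : ℂ) ^ (lam - lam') * f p,
        ((contDiffOn_abs_cpow n _).mono inter_subset_right).mul (hf.mono inter_subset_left), ?_⟩
      intro ζ hζ
      simp only [hfa ζ hζ.1]
    · intro t ht ξ
      have h0 : ((|t| : ℝ) : ℂ) ≠ 0 := by exact_mod_cast abs_ne_zero.mpr ht
      simp only [hh t ht ξ]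
      simp only [Cone.dilate, abs_mul, Complex.ofReal_mul]
      rw [Complex.mul_cpow_ofReal_nonneg (abs_nonneg _) (abs_nonneg _)]
      have e : -lam' = (lam - lam') + (-lam) := by ring
      rw [e, Complex.cpow_add _ _ h0]
      ring⟩

/-- The normalized spherical vector `𝟏_λ` of `I(λ)`: the element of `I(λ)` equal to `1` on the
sphere `ξₙ₊₁ = 1`. -/
def sphericalVector (n : ℕ) (lam : ℂ) : PS n lam :=
  ⟨fun ξ => ((|ξ.1.2| : ℝ) : ℂ) ^ (-lam), by
    refine ⟨fun ξ => ?_, ?_⟩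
    · exact ⟨{p | p.2 ≠ 0}, isOpen_ne_fun continuous_snd continuous_const, ξ.2.2, _,
        contDiffOn_abs_cpow n _, fun _ _ => rfl⟩
    · intro t ht ξ
      simp only [Cone.dilate, abs_mul, Complex.ofReal_mul]
      rw [Complex.mul_cpow_ofReal_nonneg (abs_nonneg _) (abs_nonneg _)]⟩

/-- The embedding `ι_N` of `ℝⁿ` into the cone, `x ↦ (1 - |x|², 2x, 1 + |x|²)`. The noncompact
picture of a vector `h` of `I(λ)` is the function `x ↦ h (ι_N x)`. -/
def iotaN {n : ℕ} (x : E n) : Cone n :=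
  ⟨(WithLp.toLp 2 (Fin.cons (1 - ‖x‖ ^ 2) (fun i => 2 * x i)), 1 + ‖x‖ ^ 2), by
    constructor
    · simp only [EuclideanSpace.real_norm_sq_eq, Fin.sum_univ_succ, Fin.cons_zero, Fin.cons_succ,
        mul_pow, ← Finset.mul_sum]
      ring
    · positivity⟩

/-- The point `(x, s)` of `ℝᵈ⁺¹ = ℝᵈ ⊕ ℝ`. -/
def slice {d : ℕ} (x : E d) (s : ℝ) : E (d + 1) :=
  WithLp.toLp 2 (Fin.snoc (α := fun _ => ℝ) (fun i => x i) s)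

/-- In the noncompact picture the spherical vector is `(1 + |x|²) ^ (-λ)`. -/
theorem sphericalVector_iotaN {n : ℕ} (lam : ℂ) (x : E n) :
    (sphericalVector n lam).1 (iotaN x) = ((1 + ‖x‖ ^ 2 : ℝ) : ℂ) ^ (-lam) := by
  have h : (0 : ℝ) ≤ 1 + ‖x‖ ^ 2 := by positivity
  simp only [sphericalVector, iotaN, abs_of_nonneg h]

theorem continuous_of_smoothOnCone {n : ℕ} {h : Cone n → ℂ} (hs : SmoothOnCone h)
    {γ : ℝ → E (n + 1) × ℝ} (hγ : Continuous γ)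
    (hc : ∀ s, ‖(γ s).1‖ ^ 2 = (γ s).2 ^ 2 ∧ (γ s).2 ≠ 0) :
    Continuous fun s => h ⟨γ s, hc s⟩ := by
  rw [continuous_iff_continuousAt]
  intro s
  obtain ⟨U, hU, hξU, f, hf, hfa⟩ := hs ⟨γ s, hc s⟩
  have h1 : ContinuousAt f (γ s) := (hf.continuousOn).continuousAt (hU.mem_nhds hξU)
  have h2 : ContinuousAt (fun r => f (γ r)) s :=
    ContinuousAt.comp (f := γ) (g := f) h1 hγ.continuousAt
  refine h2.congr ?_
  filter_upwards [hγ.continuousAt.eventually (hU.mem_nhds hξU)] with r hr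
  exact (hfa ⟨γ r, hc r⟩ hr).symm

/-- A vector of the principal series is determined by its noncompact picture. -/
theorem eq_of_iotaN {n : ℕ} (hn : 1 ≤ n) {lam : ℂ} {u v : PS n lam}
    (huv : ∀ x : E n, u.1 (iotaN x) = v.1 (iotaN x)) : u = v := by
  have key : ∀ ξ : Cone n, ξ.1.1 0 + ξ.1.2 ≠ 0 → u.1 ξ = v.1 ξ := by
    intro ξ hξ
    set t : ℝ := (ξ.1.1 0 + ξ.1.2) / 2 with ht
    have ht0 : t ≠ 0 := div_ne_zero hξ two_ne_zero
    set x : E n := WithLp.toLp 2 (fun i => ξ.1.1 i.succ / (2 * t)) with hx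
    have h1 := ξ.2.1
    rw [EuclideanSpace.real_norm_sq_eq, Fin.sum_univ_succ] at h1
    have h2 : ‖x‖ ^ 2 * (2 * t) ^ 2 = ∑ i : Fin n, ξ.1.1 i.succ ^ 2 := by
      rw [EuclideanSpace.real_norm_sq_eq, Finset.sum_mul]
      refine Finset.sum_congr rfl fun i _ => ?_
      simp only [hx]
      field_simp
    have h3 : ‖x‖ ^ 2 * (2 * t) = ξ.1.2 - ξ.1.1 0 := by
      have : (‖x‖ ^ 2 * (2 * t)) * (2 * t) = (ξ.1.2 - ξ.1.1 0) * (2 * t) := by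
        rw [mul_assoc, ← sq, h2]
        have : 2 * t = ξ.1.1 0 + ξ.1.2 := by rw [ht]; ring
        rw [this]
        linarith
      exact mul_right_cancel₀ (mul_ne_zero two_ne_zero ht0) this
    have h4 : ξ = (iotaN x).dilate t ht0 := by
      apply Subtype.ext
      refine Prod.ext ?_ ?_
      · ext i
        refine Fin.cases ?_ (fun j => ?_) i
        · simp only [Cone.dilate, iotaN, PiLp.smul_apply, Fin.cons_zero, smul_eq_mul]
          linarith
        · simp only [Cone.dilate, iotaN, PiLp.smul_apply, Fin.cons_succ, smul_eq_mul, hx]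
          field_simp
      · simp only [Cone.dilate, iotaN]
        linarith
    rw [h4, u.2.2, v.2.2, huv]
  apply Subtype.ext
  funext ξ
  by_cases hξ : ξ.1.1 0 + ξ.1.2 = 0
  swap
  · exact key ξ hξ
  obtain ⟨n, rfl⟩ : ∃ d, n = d + 1 := ⟨n - 1, by omega⟩
  set t := ξ.1.2 with ht
  have ht0 : t ≠ 0 := ξ.2.2
  let γ : ℝ → E (n + 1 + 1) × ℝ := fun s =>
    ((-(t * Real.cos s)) • EuclideanSpace.single 0 1 + (t * Real.sin s) •
      EuclideanSpace.single (1 : Fin (n + 2)) (1 : ℝ), t)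
  have hγ : Continuous γ := by fun_prop
  have hc : ∀ s, ‖(γ s).1‖ ^ 2 = (γ s).2 ^ 2 ∧ (γ s).2 ≠ 0 := by
    intro s
    refine ⟨?_, ht0⟩
    simp only [γ]
    rw [EuclideanSpace.real_norm_sq_eq, Fin.sum_univ_succ, Fin.sum_univ_succ]
    have h1 : ∀ i : Fin n, i.succ.succ ≠ (1 : Fin (n + 2)) := fun i hi => by
      simp [Fin.ext_iff] at hi
    simp [h1]
    linear_combination t ^ 2 * Real.sin_sq_add_cos_sq s
  have h0 : (⟨γ 0, hc 0⟩ : Cone (n + 1)) = ξ := by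
    apply Subtype.ext
    refine Prod.ext ?_ rfl
    have h1 := ξ.2.1
    rw [EuclideanSpace.real_norm_sq_eq, Fin.sum_univ_succ] at h1
    have h00 : ξ.1.1 0 = -t := by linarith
    have h2 : ∑ i : Fin (n + 1), ξ.1.1 i.succ ^ 2 = 0 := by
      rw [h00, ← ht] at h1
      linarith
    rw [Finset.sum_eq_zero_iff_of_nonneg (fun _ _ => sq_nonneg _)] at h2
    ext i
    refine Fin.cases ?_ (fun j => ?_) i
    · simp [γ, h00]
    · have := h2 j (Finset.mem_univ _)
      have h3 : ξ.1.1 j.succ = 0 := by simpa using this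
      simp [γ, h3, Fin.succ_ne_zero]
  have hu := continuous_of_smoothOnCone u.2.1 hγ hc
  have hv := continuous_of_smoothOnCone v.2.1 hγ hc
  have hev : ∀ᶠ s in 𝓝[>] (0 : ℝ), u.1 ⟨γ s, hc s⟩ = v.1 ⟨γ s, hc s⟩ := by
    filter_upwards [Ioo_mem_nhdsGT Real.pi_pos] with s hs
    apply key
    have hcos : Real.cos s < 1 := by
      have := Real.cos_lt_cos_of_nonneg_of_le_pi le_rfl hs.2.le hs.1
      simpa using this
    have : (γ s).1 0 + (γ s).2 = t * (1 - Real.cos s) := by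
      simp [γ]
      ring
    rw [this]
    exact mul_ne_zero ht0 (by linarith)
  have hu0 := (hu.tendsto 0).mono_left (nhdsWithin_le_nhds (s := Ioi 0))
  have hv0 := (hv.tendsto 0).mono_left (nhdsWithin_le_nhds (s := Ioi 0))
  have := tendsto_nhds_unique (hu0.congr' hev) hv0
  rwa [h0] at this

/-! ### The operators

Throughout, `n = m + 1`, so that `I(λ)` is `PS (m + 1) λ` and `J(ν)` is `PS m ν`. -/

/-- The kernel
`|xₙ| ^ (λ + ν - n) (|x|² + xₙ²) ^ (-ν) / (Γ((λ + ν - n + 1) / 2) Γ((λ - ν) / 2))` on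
`ℝⁿ = ℝⁿ⁻¹ ⊕ ℝ`, with `n = m + 1`. -/
def kernelA {m : ℕ} (lam nu : ℂ) (z : E (m + 1)) : ℂ :=
  1 / (Complex.Gamma ((lam + nu - m) / 2) * Complex.Gamma ((lam - nu) / 2)) *
    (((|z (Fin.last m)| : ℝ) : ℂ) ^ (lam + nu - (m + 1)) * ((‖z‖ ^ 2 : ℝ) : ℂ) ^ (-nu))

/-- `U` is the image of the vector `h` under the family of operators `Ã_{λ',ν'} : I(λ') → J(ν')`:
it depends holomorphically on `(λ', ν') ∈ ℂ²`, and on the domain `Re (λ' - ν') > 0`,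
`Re (λ' + ν') > n - 1` of local integrability it is the integral operator with the convolution
kernel `kernelA` in the noncompact picture. There is at most one such family. -/
def IsFamilyA {m : ℕ} {lam : ℂ} (h : PS (m + 1) lam) (U : ∀ _lam' nu' : ℂ, PS m nu') : Prop :=
  (∀ η : Cone m, Differentiable ℂ fun p : ℂ × ℂ => (U p.1 p.2).1 η) ∧
  ∀ lam' nu' : ℂ, 0 < (lam' - nu').re → (m : ℝ) < (lam' + nu').re → ∀ x : E m,
    (U lam' nu').1 (iotaN x) =
      ∫ y : E (m + 1), kernelA lam' nu' (y - slice x 0) * (transport lam' h).1 (iotaN y)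

open Classical in
/-- The regular symmetry breaking operator `Ã_{λ,ν} : I(λ) → J(ν)`. -/
def opA (m : ℕ) (lam nu : ℂ) (h : PS (m + 1) lam) : PS m nu :=
  if H : ∃ U : ∀ _lam' nu' : ℂ, PS m nu', IsFamilyA h U then H.choose lam nu else 0

/-- Extension by zero of a function on the cone to the ambient space. -/
def extend {n : ℕ} (h : Cone n → ℂ) (p : E (n + 1) × ℝ) : ℂ :=
  open Classical in if hp : ‖p.1‖ ^ 2 = p.2 ^ 2 ∧ p.2 ≠ 0 then h ⟨p, hp⟩ else 0

/-- The Lorentz form of signature `(d, 1)`. -/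
def lorentz {d : ℕ} (p q : E d × ℝ) : ℝ := ⟪p.1, q.1⟫_ℝ - p.2 * q.2

/-- With `[ξ, η]` the Lorentz form, `-[ι_N y, ι_N x] / 2` is `|y - x|² + yₙ²` for `y ∈ ℝⁿ` and
`x ∈ ℝⁿ⁻¹`. So the function `(|y - x|² + yₙ²) ^ (-ν)` is the restriction to `ι_N` of
`(|[ξ, η]| / 2) ^ (-ν)`, and `δ^(2k)(yₙ)` is that of `δ^(2k)(ξₙ / 2) = 2^(2k+1) δ^(2k)(ξₙ)`. -/
theorem lorentz_iotaN {m : ℕ} (y : E (m + 1)) (x : E m) :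
    -lorentz (iotaN y).1 (slice (iotaN x).1.1 0, (iotaN x).1.2) / 2 = ‖y - slice x 0‖ ^ 2 := by
  have h1 : ⟪(iotaN y).1.1, slice (iotaN x).1.1 0⟫_ℝ =
      (1 - ‖y‖ ^ 2) * (1 - ‖x‖ ^ 2) + 4 * ⟪y, slice x 0⟫_ℝ := by
    have hsl : ∀ (d : ℕ) (p : E (d + 1)) (q : E d),
        ⟪p, slice q 0⟫_ℝ = ∑ i : Fin d, q i * p i.castSucc := by
      intro d p q
      simp only [PiLp.inner_apply, slice]
      rw [Fin.sum_univ_castSucc]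
      simp [Fin.snoc_castSucc, Fin.snoc_last, mul_comm]
    rw [hsl, hsl, Fin.sum_univ_succ, Finset.mul_sum]
    have e : ∀ i : Fin m, (iotaN x).1.1 i.succ * (iotaN y).1.1 i.succ.castSucc =
        4 * (x i * y i.castSucc) := by
      intro i
      rw [← Fin.succ_castSucc]
      simp only [iotaN, Fin.cons_succ]
      ring
    rw [Finset.sum_congr rfl fun i _ => e i, Fin.castSucc_zero]
    simp only [iotaN, Fin.cons_zero]
    ring
  have h2 : ‖slice x 0‖ ^ 2 = ‖x‖ ^ 2 := by
    simp only [EuclideanSpace.real_norm_sq_eq, slice]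
    rw [Fin.sum_univ_castSucc]
    simp
  rw [lorentz, h1, norm_sub_sq_real, h2]
  simp only [iotaN]
  ring

/-- For `λ + ν = n - 1 - 2k`, `n = m + 1`, the pairing of a vector `h` of `I(λ)` with the
distribution
`Γ((λ - ν) / 2)⁻¹ δ^(2k)(ξₙ / 2) (|[ξ, η]| / 2) ^ (-ν)`
on the cone, where `η` is a point of the smaller cone (embedded by `ηₙ = 0`). For `η = ι_N x` the
restriction of this distribution to `ξ = ι_N y` is
`Γ((λ - ν) / 2)⁻¹ (|y - x|² + yₙ²) ^ (-ν) δ^(2k)(yₙ)`.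
The pairing `∫ dy` over `ℝⁿ` is `2⁻ⁿ` times the integral over the sphere `ξₙ₊₁ = 1`, because the
integrand is homogeneous of degree `-n` in `ξ`. The points of the sphere `Sⁿ` are written as
`(√(1 - s²) w, s)` with `w ∈ Sⁿ⁻¹` and `s = ξₙ`; the Riemannian measure is
`(1 - s²) ^ ((n - 2) / 2) ds dw`. -/
def pairingB {m : ℕ} (k : ℕ) (lam nu : ℂ) (h : PS (m + 1) lam) (η : Cone m) : ℂ :=
  (2 : ℂ) ^ (2 * k + 1) / (2 ^ (m + 1) * Complex.Gamma ((lam - nu) / 2)) *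
    ∫ w : Metric.sphere (0 : E (m + 1)) 1,
      iteratedDeriv (2 * k) (fun s : ℝ =>
        (((1 - s ^ 2) ^ (((m : ℝ) - 1) / 2) : ℝ) : ℂ) *
        ((|lorentz (slice (√(1 - s ^ 2) • w.1) s, 1) (slice η.1.1 0, η.1.2)| / 2 : ℝ) : ℂ) ^ (-nu) *
        extend h.1 (slice (√(1 - s ^ 2) • w.1) s, 1)) 0
      ∂(volume : Measure (E (m + 1))).toSphere

/-- `U` is the image of the vector `h` under the family of operators `B̃_{λ',ν'} : I(λ') → J(ν')`
on the complex line `λ' + ν' = n - 1 - 2k`: it is holomorphic on this line, and for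
`Re (λ' - ν') > 0` it is given by the absolutely convergent pairing with the kernel. The values of
`U` off the line are irrelevant; on the line there is at most one such family. -/
def IsFamilyB {m : ℕ} (k : ℕ) {lam : ℂ} (h : PS (m + 1) lam) (U : ∀ _lam' nu' : ℂ, PS m nu') :
    Prop :=
  (∀ η : Cone m, Differentiable ℂ fun z : ℂ => (U z (m - 2 * k - z)).1 η) ∧
  ∀ lam' nu' : ℂ, lam' + nu' = m - 2 * k → 0 < (lam' - nu').re → ∀ η : Cone m,
    (U lam' nu').1 η = pairingB k lam' nu' (transport lam' h) η

open Classical in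
/-- The singular symmetry breaking operator `B̃_{λ,ν} : I(λ) → J(ν)`, for
`λ + ν = n - 1 - 2k` and `n = m + 1`. -/
def opB (m k : ℕ) (lam nu : ℂ) (h : PS (m + 1) lam) : PS m nu :=
  if H : ∃ U : ∀ _lam' nu' : ℂ, PS m nu', IsFamilyB k h U then H.choose lam nu else 0

/-- The differential operator
`rest ∘ ∑_{j ≤ l} 2^(2l-2j) / (j! (2l-2j)!) ∏_{i=1}^{l-j} ((λ + ν - n - 1) / 2 + i)
Δ_{ℝⁿ⁻¹}^j (∂/∂xₙ)^(2l-2j)`, with `n = m + 1`, from functions on `ℝⁿ` to functions on `ℝⁿ⁻¹`. -/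
def diffOpC {m : ℕ} (l : ℕ) (lam nu : ℂ) (F : E (m + 1) → ℂ) (x : E m) : ℂ :=
  ∑ j ∈ Finset.range (l + 1),
    (2 : ℂ) ^ (2 * l - 2 * j) * (∏ i ∈ Finset.Icc 1 (l - j), ((lam + nu - m - 2) / 2 + i)) /
      (Nat.factorial j * Nat.factorial (2 * l - 2 * j)) *
    (Laplacian.laplacian : (E m → ℂ) → E m → ℂ)^[j]
      (fun x' => iteratedDeriv (2 * l - 2 * j) (fun s : ℝ => F (slice x' s)) 0) x

open Classical in
/-- The differential symmetry breaking operator `C̃_{λ,ν} : I(λ) → J(ν)`, for `ν - λ = 2l`: the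
noncompact picture of the image is obtained by applying `diffOpC` to the noncompact picture of the
vector. -/
def opC (m l : ℕ) (lam nu : ℂ) (h : PS (m + 1) lam) : PS m nu :=
  if H : ∃ u : PS m nu, ∀ x : E m, u.1 (iotaN x) = diffOpC l lam nu (fun y => h.1 (iotaN y)) x
  then H.choose else 0

end SymmetryBreaking

end

noncomputable section

namespace SymmetryBreaking

/-! ### Uniqueness of the families -/

/-! The families defining `opA` and `opB` are unique: two of them agree on a half-plane of a complex
line of parameters, hence on the whole line. The right-hand sides are holomorphic in the parameters
because `1/Γ` is entire, so it is enough to evaluate the convergent integrals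
(`isFamilyA_spherical`, `isFamilyB_spherical`). For `opC` a vector is determined by its noncompact
picture, and the differential operator has to be computed on `(1 + |y|²)^(-λ)`.

Regular operators. A Euclidean inversion exchanging `0` and `x` preserves the hyperplane `yₙ = 0`
and rescales `1 + |y|²` by its conformal factor. All powers of that factor cancel against the
Jacobian, so the integral at `x` is `(1 + |x|²)^(-ν)` times the one at `0` (`integral_kernel`). The
latter splits in polar coordinates into a sphere integral of `|wₙ|^a` and a Beta integral
(`integral_kernel_zero`).

Singular operators. On the sphere the kernel applied to the spherical vector is a function of `s²`
and of `τ = ⟨w, e⟩`, where `e` is the direction of `η`. Its derivative of order `2k` at `s = 0` is a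
polynomial in the Euler operator `t d/dt` applied to `(1 - t)^(-ν)`, at `t = τ`
(`iteratedDeriv_zonal`). The integral over `w` is one-dimensional, with the Gegenbauer weight
(`integral_sphere_zonal`). Since the Gegenbauer operator integrates to zero, these integrals satisfy
a two-term recurrence in the order of the derivative, which gives a quotient of Gamma values
(`gegenbauer_radialCoeff`, `functional_radialCoeff`).

Differential operators. Normal derivatives and Laplacians keep the span of the functions `vᵢ = (λ)ᵢ
(1 + |x|²)^(-(λ+i))`, where `Δ/4` acts by `vᵢ ↦ (c + i) vᵢ₊₁ - vᵢ₊₂`. The identity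
`sum_choose_ascPochhammer_pow` expands the whole operator, and for the given coefficients only the
`v₂ₗ` term survives (`diffOpC_spherical`). -/

theorem eq_of_eqOn_halfPlane {f g : ℂ → ℂ} (hf : Differentiable ℂ f) (hg : Differentiable ℂ g)
    (R : ℝ) (h : ∀ z : ℂ, R < z.re → f z = g z) : f = g := by
  have hf' : AnalyticOnNhd ℂ f univ := fun z _ => hf.analyticAt z
  have hg' : AnalyticOnNhd ℂ g univ := fun z _ => hg.analyticAt z
  refine hf'.eq_of_eventuallyEq hg' (z₀ := ((R + 1 : ℝ) : ℂ)) ?_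
  have ho : IsOpen {z : ℂ | R < z.re} := isOpen_lt continuous_const Complex.continuous_re
  filter_upwards [ho.mem_nhds (show R < (((R + 1 : ℝ) : ℂ)).re by simp)] with z hz
  exact h z hz

theorem transport_sphericalVector (n : ℕ) (lam lam' : ℂ) :
    transport lam' (sphericalVector n lam) = sphericalVector n lam' := by
  apply Subtype.ext
  funext ξ
  have h0 : ((|ξ.1.2| : ℝ) : ℂ) ≠ 0 := by exact_mod_cast abs_ne_zero.mpr ξ.2.2
  simp only [transport, sphericalVector]
  rw [← Complex.cpow_add _ _ h0]
  ring_nf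

theorem IsFamilyA.opA_eq {m : ℕ} (hm : 1 ≤ m) {lam : ℂ} (nu : ℂ) {h : PS (m + 1) lam}
    {U : ∀ _lam' nu' : ℂ, PS m nu'} (hU : IsFamilyA h U) : opA m lam nu h = U lam nu := by
  have H : ∃ U : ∀ _lam' nu' : ℂ, PS m nu', IsFamilyA h U := ⟨U, hU⟩
  rw [opA, dif_pos H]
  have hV := H.choose_spec
  set V := H.choose
  refine eq_of_iotaN hm fun x => ?_
  -- Only `λ` moves. Joint holomorphy restricts to this line, and for `Re z` large both convergence
  -- conditions hold, so the two families are given there by the same integral.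
  have hd : Differentiable ℂ fun z : ℂ => ((lam + z, nu) : ℂ × ℂ) := by fun_prop
  have := eq_of_eqOn_halfPlane ((hV.1 (iotaN x)).comp hd) ((hU.1 (iotaN x)).comp hd)
    (max (nu.re - lam.re) (m - nu.re - lam.re)) (fun z hz => by
      obtain ⟨h1, h2⟩ := max_lt_iff.mp hz
      have h1' : 0 < (lam + z - nu).re := by simp; linarith
      have h2' : (m : ℝ) < (lam + z + nu).re := by simp; linarith
      simp only [Function.comp]
      rw [hV.2 _ _ h1' h2', hU.2 _ _ h1' h2'])
  simpa using congrFun this 0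

theorem IsFamilyB.opB_eq {m k : ℕ} {lam nu : ℂ} (hl : nu = m - 2 * k - lam)
    {h : PS (m + 1) lam} {U : ∀ _lam' nu' : ℂ, PS m nu'} (hU : IsFamilyB k h U) :
    opB m k lam nu h = U lam nu := by
  have H : ∃ U : ∀ _lam' nu' : ℂ, PS m nu', IsFamilyB k h U := ⟨U, hU⟩
  rw [opB, dif_pos H]
  have hV := H.choose_spec
  set V := H.choose
  subst hl
  apply Subtype.ext
  funext η
  have := eq_of_eqOn_halfPlane (hV.1 η) (hU.1 η) (m / 2 - k) (fun z hz => by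
      have h1 : 0 < (z - (m - 2 * k - z) : ℂ).re := by simp; linarith
      have h2 : z + (m - 2 * k - z : ℂ) = m - 2 * k := by ring
      rw [hV.2 _ _ h2 h1, hU.2 _ _ h2 h1])
  exact congrFun this lam

theorem opC_eq {m l : ℕ} (hm : 1 ≤ m) {lam nu : ℂ} {h : PS (m + 1) lam} {u : PS m nu}
    (hu : ∀ x : E m, u.1 (iotaN x) = diffOpC l lam nu (fun y => h.1 (iotaN y)) x) :
    opC m l lam nu h = u := by
  have H : ∃ u : PS m nu, ∀ x : E m,
    u.1 (iotaN x) = diffOpC l lam nu (fun y => h.1 (iotaN y)) x := ⟨u, hu⟩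
  rw [opC, dif_pos H]
  exact eq_of_iotaN hm fun x => by rw [H.choose_spec x, hu x]

/-! ### Derivatives of even functions at the origin -/

theorem hasDerivAt_comp_sq {G : ℝ → ℂ} {G' : ℂ} {s : ℝ} (h : HasDerivAt G G' (s ^ 2)) :
    HasDerivAt (fun s : ℝ => G (s ^ 2)) (2 * s * G') s := by
  have h1 : HasDerivAt (fun s : ℝ => s ^ 2) (2 * s) s := by simpa using hasDerivAt_pow 2 s
  have h2 := HasDerivAt.scomp (h := fun s : ℝ => s ^ 2) s h h1
  simpa [Function.comp_def] using h2

/-- Only the Taylor coefficient of `u^k` in `G 0` contributes to `s^(2k)`. The induction avoids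
Taylor series: two derivatives of `G(s²)` give again a function of `s²`, namely `2 G' + 4 u G''` at
`u = s²`. -/
theorem iteratedDeriv_comp_sq {r : ℝ} (hr : 0 < r) (k : ℕ) {G : ℕ → ℝ → ℂ}
    (hG : ∀ j u, |u| < r → HasDerivAt (G j) (G (j + 1) u) u) :
    iteratedDeriv (2 * k) (fun s : ℝ => G 0 (s ^ 2)) 0 =
      ((2 * k).factorial / k.factorial : ℂ) * G k 0 := by
  induction k generalizing G with
  | zero => simp
  | succ k ih =>
    -- `H j` is the `j`-th derivative of `2 G' + 4 u G''` by the Leibniz rule. At `u = 0` it is `(4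
    -- j + 2) G (j + 1)`, and `4 k + 2` is the ratio of consecutive values of `(2k)!/k!`.
    set H : ℕ → ℝ → ℂ := fun j u => 2 * G (j + 1) u + 4 * (u * G (j + 2) u + j * G (j + 1) u)
      with hH
    have hH' : ∀ j u, |u| < r → HasDerivAt (H j) (H (j + 1) u) u := by
      intro j u hu
      have h1 := hG (j + 1) u hu
      have h2 := hG (j + 2) u hu
      have h3 := ((h1.const_mul 2).add ((((hasDerivAt_id u).ofReal_comp.mul h2).add
        (h1.const_mul (j : ℂ))).const_mul 4))
      refine h3.congr_deriv ?_
      simp only [hH]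
      push_cast
      simp
      ring
    have hnear : ∀ᶠ s : ℝ in 𝓝 0, |s ^ 2| < r := by
      have : ContinuousAt (fun s : ℝ => |s ^ 2|) 0 := by fun_prop
      exact this.eventually (gt_mem_nhds (by simpa using hr))
    have hd1 : deriv (fun s : ℝ => G 0 (s ^ 2)) =ᶠ[𝓝 0] fun s => 2 * s * G 1 (s ^ 2) := by
      filter_upwards [hnear] with s hs
      exact (hasDerivAt_comp_sq (hG 0 _ hs)).deriv
    have hd2 : deriv (deriv fun s : ℝ => G 0 (s ^ 2)) =ᶠ[𝓝 0] fun s => H 0 (s ^ 2) := by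
      refine hd1.deriv.trans ?_
      filter_upwards [hnear] with s hs
      have h1 := hasDerivAt_comp_sq (hG 1 _ hs)
      have h2 : HasDerivAt (fun s : ℝ => (2 * s : ℂ)) 2 s := by
        simpa using (hasDerivAt_id s).ofReal_comp.const_mul (2 : ℂ)
      refine (h2.mul h1).deriv.trans ?_
      simp only [hH]
      push_cast
      ring
    rw [show 2 * (k + 1) = 2 * k + 1 + 1 by ring, iteratedDeriv_succ', iteratedDeriv_succ',
      hd2.iteratedDeriv_eq, ih hH']
    simp only [hH, Nat.factorial_succ]
    have : (k.factorial : ℂ) ≠ 0 := by exact_mod_cast k.factorial_ne_zero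
    have : (k + 1 : ℂ) ≠ 0 := by exact_mod_cast k.succ_ne_zero
    push_cast
    field_simp
    ring

theorem hasDerivAt_add_cpow {A u : ℝ} (c : ℂ) (h : 0 < A + u) :
    HasDerivAt (fun u : ℝ => ((A + u : ℝ) : ℂ) ^ (-c))
      (-c * ((A + u : ℝ) : ℂ) ^ (-(c + 1))) u := by
  have h1 := ((hasDerivAt_id (((A + u : ℝ) : ℂ))).cpow_const (c := -c)
    (Or.inl (by simpa using h))).comp_ofReal.comp_const_add A u
  refine h1.congr_deriv ?_
  simp only [id, mul_one]
  congr 2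
  ring

theorem iteratedDeriv_add_sq_cpow {A : ℝ} (hA : 0 < A) (c : ℂ) (k : ℕ) :
    iteratedDeriv (2 * k) (fun s : ℝ => ((A + s ^ 2 : ℝ) : ℂ) ^ (-c)) 0 =
      ((2 * k).factorial / k.factorial : ℂ) *
        ((-1) ^ k * (ascPochhammer ℂ k).eval c * (A : ℂ) ^ (-(c + k))) := by
  have := iteratedDeriv_comp_sq hA k (G := fun j u => (-1) ^ j * (ascPochhammer ℂ j).eval c *
    ((A + u : ℝ) : ℂ) ^ (-(c + j))) (fun j u hu => by
      have h := (hasDerivAt_add_cpow (c + j) (show 0 < A + u by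
        linarith [neg_abs_le u])).const_mul ((-1) ^ j * (ascPochhammer ℂ j).eval c)
      refine h.congr_deriv ?_
      rw [ascPochhammer_succ_eval]
      push_cast
      ring_nf)
  simpa using this

/-! ### The Laplacian of powers of `1 + |x|²` -/

/-- The power `(1 + |x|²) ^ (-c)`. -/
def japanesePow {m : ℕ} (c : ℂ) (x : E m) : ℂ := ((1 + ‖x‖ ^ 2 : ℝ) : ℂ) ^ (-c)

theorem hasFDerivAt_japanesePow {m : ℕ} (c : ℂ) (x : E m) :
    HasFDerivAt (japanesePow c)
      ((-2 * c * japanesePow (c + 1) x) • (Complex.ofRealCLM.comp (innerSL ℝ x))) x := by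
  have h1 : HasFDerivAt (fun x : E m => ‖x‖ ^ 2) (2 • innerSL ℝ x) x :=
    (hasStrictFDerivAt_norm_sq x).hasFDerivAt
  have h2 := (hasDerivAt_add_cpow (A := 1) (u := ‖x‖ ^ 2) c
    (by positivity)).hasFDerivAt.comp x h1
  refine h2.congr_fderiv ?_
  ext v
  simp [japanesePow]
  ring

/-- Bootstrapping in `c`: the derivative of the power `c` is a smooth factor times the power `c +
1`, so regularity for every `c` improves by one order. -/
theorem contDiff_japanesePow {m : ℕ} (c : ℂ) : ContDiff ℝ 2 (japanesePow c : E m → ℂ) := by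
  have h0 : ∀ c : ℂ, ContDiff ℝ 0 (japanesePow c : E m → ℂ) := fun c => by
    rw [contDiff_zero]
    exact (show Differentiable ℝ (japanesePow c : E m → ℂ) from
      fun x => (hasFDerivAt_japanesePow c x).differentiableAt).continuous
  have step : ∀ (n : ℕ), (∀ c : ℂ, ContDiff ℝ n (japanesePow c : E m → ℂ)) →
      ∀ c : ℂ, ContDiff ℝ (n + 1) (japanesePow c : E m → ℂ) := fun n hn c => by
    rw [contDiff_succ_iff_hasFDerivAt]
    refine ⟨_, ?_, fun x => hasFDerivAt_japanesePow c x⟩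
    refine (contDiff_const.mul (hn (c + 1))).smul ?_
    exact contDiff_const.clm_comp (innerSL ℝ).contDiff
  have h1 := step 0 (by simpa using h0)
  have h2 := step 1 (by simpa using h1)
  simpa [one_add_one_eq_two] using h2 c

theorem laplacian_japanesePow {m : ℕ} (c : ℂ) :
    Laplacian.laplacian (japanesePow c : E m → ℂ) =
      (4 * c * (c + 1 - m / 2)) • japanesePow (c + 1) -
        (4 * c * (c + 1)) • japanesePow (c + 2) := by
  rw [InnerProductSpace.laplacian_eq_iteratedFDeriv_orthonormalBasis _
    (EuclideanSpace.basisFun (Fin m) ℝ)]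
  funext x
  have hx : ∀ i, iteratedFDeriv ℝ 2 (japanesePow c : E m → ℂ) x
      ![EuclideanSpace.basisFun (Fin m) ℝ i, EuclideanSpace.basisFun (Fin m) ℝ i] =
      4 * c * (c + 1) * japanesePow (c + 2) x * ((x i) ^ 2 : ℝ) -
        2 * c * japanesePow (c + 1) x := by
    intro i
    rw [iteratedFDeriv_two_apply]
    simp only [Matrix.cons_val_zero, Matrix.cons_val_one]
    set e := EuclideanSpace.basisFun (Fin m) ℝ i with he
    have hdiff : DifferentiableAt ℝ (fderiv ℝ (japanesePow c : E m → ℂ)) x :=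
      ((contDiff_japanesePow c).fderiv_right (m := 1) (by norm_num)).differentiable
        (by norm_num) x
    have h1 : fderiv ℝ (fderiv ℝ (japanesePow c : E m → ℂ)) x e e =
        fderiv ℝ (fun y => fderiv ℝ (japanesePow c : E m → ℂ) y e) x e := by
      rw [fderiv_clm_apply hdiff (differentiableAt_const e)]
      simp
    have h2 : (fun y => fderiv ℝ (japanesePow c : E m → ℂ) y e) =
        fun y => (-2 * c * japanesePow (c + 1) y) * ((⟪e, y⟫_ℝ : ℝ) : ℂ) := by
      funext y
      rw [(hasFDerivAt_japanesePow c y).fderiv]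
      simp [real_inner_comm]
    have h3 : HasFDerivAt (fun y : E m => ((⟪e, y⟫_ℝ : ℝ) : ℂ))
        (Complex.ofRealCLM.comp (innerSL ℝ e)) x :=
      (Complex.ofRealCLM.comp (innerSL ℝ e)).hasFDerivAt
    have h4 := ((hasFDerivAt_japanesePow (m := m) (c + 1) x).const_mul (-2 * c)).mul h3
    have h5 : ⟪e, x⟫_ℝ = x i := by simp [he, EuclideanSpace.inner_single_left]
    have h6 : ‖e‖ = 1 := by simp [he]
    rw [h1, h2]
    refine (congrArg (fun T => T e) h4.fderiv).trans ?_
    simp [h5, h6, real_inner_comm e x, add_assoc, one_add_one_eq_two]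
    ring
  rw [Finset.sum_congr rfl fun i _ => hx i, Finset.sum_sub_distrib, ← Finset.mul_sum,
    ← Complex.ofReal_sum, ← EuclideanSpace.real_norm_sq_eq]
  have h0 : ((1 + ‖x‖ ^ 2 : ℝ) : ℂ) ≠ 0 := by
    have : 0 < 1 + ‖x‖ ^ 2 := by positivity
    exact_mod_cast this.ne'
  have h1 : japanesePow (c + 1) x = japanesePow (c + 2) x * ((1 + ‖x‖ ^ 2 : ℝ) : ℂ) := by
    simp only [japanesePow]
    conv_rhs => rw [← Complex.cpow_one (((1 + ‖x‖ ^ 2 : ℝ) : ℂ)), Complex.cpow_one, mul_comm]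
    rw [show -(c + 1) = 1 + -(c + 2) by ring, Complex.cpow_add _ _ h0, Complex.cpow_one]
  simp only [Finset.sum_const, Finset.card_univ, Fintype.card_fin, nsmul_eq_mul, Pi.sub_apply,
    Pi.smul_apply, smul_eq_mul]
  rw [h1]
  push_cast
  ring

/-! ### The combinatorial identity for the differential operators -/

section Combinatorics

variable {M : Type*} [AddCommGroup M] [Module ℂ M]

theorem descPochhammer_eval_succ_left (q : ℕ) (g : ℂ) :
    (descPochhammer ℂ (q + 1)).eval g = g * (descPochhammer ℂ q).eval (g - 1) := by
  simp [descPochhammer_succ_left]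

theorem descPochhammer_eval_succ_sub (q : ℕ) (g : ℂ) :
    (descPochhammer ℂ (q + 1)).eval g =
      (descPochhammer ℂ (q + 1)).eval (g - 1) + (q + 1) * (descPochhammer ℂ q).eval (g - 1) := by
  rw [descPochhammer_eval_succ_left, descPochhammer_succ_eval]
  ring

/-- After an index shift the two sums cancel term by term, by `C(l, q+1) (q+1) = C(l, q) (l-q)` and
the difference rule for falling factorials. The unpaired end terms vanish because `l - q = 0` in one
and a difference of equal constants appears in the other. -/
theorem sum_choose_descPochhammer_telescope (l : ℕ) (g : ℂ) (V : ℕ → M) :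
    ∑ q ∈ Finset.range (l + 1), ((l.choose q : ℂ) * ((-1) ^ (l - q) * (l - q : ℕ) *
        (descPochhammer ℂ q).eval (g - 1))) • V (q + 1) +
      ∑ q ∈ Finset.range (l + 1), ((l.choose q : ℂ) * ((-1) ^ (l - q) *
        ((descPochhammer ℂ q).eval g - (descPochhammer ℂ q).eval (g - 1)))) • V q = 0 := by
  rw [Finset.sum_range_succ, Finset.sum_range_succ']
  simp only [tsub_self, CharP.cast_eq_zero, mul_zero, zero_mul, zero_smul, add_zero,
    descPochhammer_zero, Polynomial.eval_one, sub_self]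
  rw [← Finset.sum_add_distrib]
  refine Finset.sum_eq_zero fun q hq => ?_
  rw [Finset.mem_range] at hq
  rw [← add_smul, descPochhammer_eval_succ_sub]
  convert zero_smul ℂ _
  obtain ⟨r, rfl⟩ : ∃ r, l = q + 1 + r := ⟨l - (q + 1), by omega⟩
  have h := Nat.choose_succ_right_eq (q + 1 + r) q
  have h' : ((q + 1 + r).choose (q + 1) : ℂ) * (q + 1) =
      ((q + 1 + r).choose q : ℂ) * ((q + 1 + r - q : ℕ) : ℂ) := by exact_mod_cast h
  rw [show q + 1 + r - q = r + 1 by omega] at *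
  rw [show q + 1 + r - (q + 1) = r by omega]
  linear_combination (-1) ^ r * (descPochhammer ℂ q).eval (g - 1) * h'

/-- Induction on `l`. Pascal's rule and `(b)ₚ₊₁ = b (b+1)ₚ` write the left side for `l + 1` as `D`
of the sum for `(i, b)` minus `b` times the sum for `(i+1, b+1)`. Both have the same
falling-factorial argument `g - 1`, with `g = c + i + l - b`, whereas the target has `g`; the
telescoping lemma accounts for the difference. -/
theorem sum_choose_ascPochhammer_pow (D : M →ₗ[ℂ] M) (v : ℕ → M) (c : ℂ)
    (hD : ∀ i : ℕ, D (v i) = (c + i) • v (i + 1) - v (i + 2)) (l i : ℕ) (b : ℂ) :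
    ∑ p ∈ Finset.HasAntidiagonal.antidiagonal l, l.choose p.1 •
        ((-1) ^ p.1 * (ascPochhammer ℂ p.1).eval b) • (D ^ p.2) (v (i + p.1)) =
      ∑ p ∈ Finset.HasAntidiagonal.antidiagonal l, l.choose p.1 •
        ((-1) ^ p.2 * (descPochhammer ℂ p.1).eval (c + i + l - 1 - b)) • v (i + p.1 + 2 * p.2) := by
  induction l generalizing i b with
  | zero => simp
  | succ l ih =>
    rw [Finset.sum_antidiagonal_choose_succ_nsmul (n := l)
      (fun a b' => ((-1) ^ a * (ascPochhammer ℂ a).eval b) • (D ^ b') (v (i + a))),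
      Finset.sum_antidiagonal_choose_succ_nsmul (n := l)
      (fun a b' => ((-1) ^ b' * (descPochhammer ℂ a).eval (c + i + (l + 1 : ℕ) - 1 - b)) •
        v (i + a + 2 * b'))]
    have e1 : ∑ ij ∈ Finset.HasAntidiagonal.antidiagonal l, l.choose ij.1 •
        ((-1) ^ ij.1 * (ascPochhammer ℂ ij.1).eval b) • (D ^ (ij.2 + 1)) (v (i + ij.1)) =
        D (∑ p ∈ Finset.HasAntidiagonal.antidiagonal l, l.choose p.1 •
        ((-1) ^ p.1 * (ascPochhammer ℂ p.1).eval b) • (D ^ p.2) (v (i + p.1))) := by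
      rw [map_sum]
      refine Finset.sum_congr rfl fun p _ => ?_
      rw [map_nsmul, map_smul, pow_succ']
      rfl
    have e2 : ∑ ij ∈ Finset.HasAntidiagonal.antidiagonal l, l.choose ij.2 •
        ((-1) ^ (ij.1 + 1) * (ascPochhammer ℂ (ij.1 + 1)).eval b) •
          (D ^ ij.2) (v (i + (ij.1 + 1))) =
        (-b) • (∑ p ∈ Finset.HasAntidiagonal.antidiagonal l, l.choose p.1 •
        ((-1) ^ p.1 * (ascPochhammer ℂ p.1).eval (b + 1)) • (D ^ p.2) (v (i + 1 + p.1))) := by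
      rw [Finset.smul_sum]
      refine Finset.sum_congr rfl fun p hp => ?_
      rw [Finset.HasAntidiagonal.mem_antidiagonal] at hp
      rw [← hp, ← Nat.choose_symm_add, smul_comm (-b), smul_smul]
      congr 2
      · rw [ascPochhammer_succ_left]
        simp
        ring
      · congr 2; ring
    rw [e1, e2, ih, ih, map_sum, Finset.smul_sum, Finset.Nat.sum_antidiagonal_eq_sum_range_succ_mk,
      Finset.Nat.sum_antidiagonal_eq_sum_range_succ_mk,
      Finset.Nat.sum_antidiagonal_eq_sum_range_succ_mk,
      Finset.Nat.sum_antidiagonal_eq_sum_range_succ_mk, ← Finset.sum_add_distrib,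
      ← Finset.sum_add_distrib]
    have T := sum_choose_descPochhammer_telescope l (c + i + l - b)
      (fun q => v (i + 2 * (l + 1) - q))
    rw [← Finset.sum_add_distrib] at T
    rw [← sub_eq_zero, ← Finset.sum_sub_distrib, ← T]
    refine Finset.sum_congr rfl fun q hq => ?_
    rw [Finset.mem_range] at hq
    obtain ⟨r, rfl⟩ : ∃ r, l = q + r := ⟨l - q, by omega⟩
    have hc : (q + r).choose r = (q + r).choose q := Nat.choose_symm_add.symm
    simp only [Nat.add_sub_cancel_left, hc]
    rw [map_nsmul, map_smul, hD, show i + 1 + q + 2 * r = i + q + 2 * r + 1 by ring,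
      show i + (q + 1) + 2 * r = i + q + 2 * r + 1 by ring,
      show i + 2 * (q + r + 1) - (q + 1) = i + q + 2 * r + 1 by omega,
      show i + 2 * (q + r + 1) - q = i + q + 2 * r + 2 by omega,
      show i + q + 2 * (r + 1) = i + q + 2 * r + 2 by ring,
      descPochhammer_eval_succ_left]
    push_cast
    rw [show c + i + (q + r) - 1 - b = c + i + (q + r) - b - 1 by ring,
      show c + (i + 1) + (q + r) - 1 - (b + 1) = c + i + (q + r) - b - 1 by ring,
      show c + i + (q + r + 1) - 1 - b = c + i + (q + r) - b by ring]
    simp only [← Nat.cast_smul_eq_nsmul ℂ]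
    module

end Combinatorics

/-! ### The differential operators on the spherical vector -/

theorem norm_slice_sq {d : ℕ} (x : E d) (s : ℝ) : ‖slice x s‖ ^ 2 = ‖x‖ ^ 2 + s ^ 2 := by
  simp only [EuclideanSpace.real_norm_sq_eq, slice]
  rw [Fin.sum_univ_castSucc]
  simp

/-- The functions `(lam)_i (1 + |x|²) ^ (-(lam + i))`. -/
def japaneseFam (m : ℕ) (lam : ℂ) (i : ℕ) : E m → ℂ :=
  (ascPochhammer ℂ i).eval lam • japanesePow (lam + i)

theorem contDiff_linearCombination_japaneseFam {m : ℕ} (lam : ℂ) (p : ℕ →₀ ℂ) :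
    ContDiff ℝ 2 (Finsupp.linearCombination ℂ (japaneseFam m lam) p) := by
  induction p using Finsupp.induction_linear with
  | zero => rw [map_zero]; exact contDiff_const
  | add f g hf hg => rw [map_add]; exact hf.add hg
  | single i a =>
    rw [Finsupp.linearCombination_single]
    exact ((contDiff_japanesePow (lam + i)).const_smul
      ((ascPochhammer ℂ i).eval lam)).const_smul a

/-- The action of a quarter of the Laplacian on the coefficients with respect to
`japaneseFam`. -/
def quarterLaplacian (c : ℂ) : (ℕ →₀ ℂ) →ₗ[ℂ] (ℕ →₀ ℂ) :=
  Finsupp.linearCombination ℂ fun i : ℕ =>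
    (c + i) • Finsupp.single (i + 1) (1 : ℂ) - Finsupp.single (i + 2) 1

/-- The Laplacian is additive only on sufficiently regular functions, so it is lifted to a linear
map on formal coefficients. The combinatorial identity and powers of the operator then take place in
the free module. -/
theorem laplacian_linearCombination_japaneseFam {m : ℕ} (lam : ℂ) (p : ℕ →₀ ℂ) :
    Laplacian.laplacian (Finsupp.linearCombination ℂ (japaneseFam m lam) p) =
      (4 : ℂ) • Finsupp.linearCombination ℂ (japaneseFam m lam)
        (quarterLaplacian (lam + 1 - m / 2) p) := by
  induction p using Finsupp.induction_linear with
  | zero =>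
    have : (0 : E m → ℂ) = fun _ => 0 := rfl
    simp only [map_zero, smul_zero]
    rw [this, InnerProductSpace.laplacian_const]
    rfl
  | add f g hf hg =>
    rw [map_add, map_add, map_add, smul_add, ← hf, ← hg]
    funext x
    exact ((contDiff_linearCombination_japaneseFam lam f).contDiffAt).laplacian_add
      (contDiff_linearCombination_japaneseFam lam g).contDiffAt
  | single i a =>
    rw [quarterLaplacian, Finsupp.linearCombination_single, Finsupp.linearCombination_single,
      map_smul, map_sub, map_smul, Finsupp.linearCombination_single,
      Finsupp.linearCombination_single, japaneseFam, smul_smul]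
    funext x
    rw [InnerProductSpace.laplacian_smul _ (contDiff_japanesePow (lam + i)).contDiffAt,
      laplacian_japanesePow]
    simp only [japaneseFam, Pi.smul_apply, Pi.sub_apply, smul_eq_mul, ascPochhammer_succ_eval]
    push_cast
    rw [show lam + (i : ℂ) + 1 = lam + (i + 1) by ring,
      show lam + (i : ℂ) + 2 = lam + (i + 2) by ring]
    ring

theorem iterate_laplacian_linearCombination_japaneseFam {m : ℕ} (lam : ℂ) (j : ℕ)
    (p : ℕ →₀ ℂ) :
    (Laplacian.laplacian : (E m → ℂ) → E m → ℂ)^[j]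
        (Finsupp.linearCombination ℂ (japaneseFam m lam) p) =
      (4 : ℂ) ^ j • Finsupp.linearCombination ℂ (japaneseFam m lam)
        ((quarterLaplacian (lam + 1 - m / 2) ^ j) p) := by
  induction j generalizing p with
  | zero => simp
  | succ j ih =>
    rw [Function.iterate_succ_apply, laplacian_linearCombination_japaneseFam, ← map_smul, ih,
      pow_succ _ j, pow_succ _ j, map_smul, map_smul, smul_smul]
    rfl

theorem prod_Icc_add_eq_ascPochhammer (p : ℕ) (a : ℂ) :
    ∏ i ∈ Finset.Icc 1 p, (a + i) = (ascPochhammer ℂ p).eval (a + 1) := by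
  induction p with
  | zero => simp
  | succ p ih =>
    rw [Finset.prod_Icc_succ_top (by omega), ih, ascPochhammer_succ_eval]
    push_cast
    ring

theorem diffOpC_spherical {m : ℕ} (l : ℕ) (lam nu : ℂ) (hnu : nu = lam + 2 * l) (x : E m) :
    diffOpC l lam nu (fun y => (sphericalVector (m + 1) lam).1 (iotaN y)) x =
      (-1) ^ l * 2 ^ (2 * l) * (ascPochhammer ℂ (2 * l)).eval lam / (Nat.factorial l : ℂ) *
        japanesePow nu x := by
  have hl0 : (l.factorial : ℂ) ≠ 0 := by exact_mod_cast l.factorial_ne_zero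
  set c : ℂ := lam + 1 - m / 2 with hc
  set b : ℂ := lam + l - m / 2 with hb
  set Φ := Finsupp.linearCombination ℂ (japaneseFam m lam) with hΦ
  -- With `p = l - j`. The factor `(2p)!` cancels the one in the denominator of the operator, and
  -- the remaining `1/(p! j!)` becomes a binomial coefficient divided by `l!`.
  have hinner : ∀ p : ℕ, (fun x' : E m => iteratedDeriv (2 * p)
      (fun s : ℝ => (sphericalVector (m + 1) lam).1 (iotaN (slice x' s))) 0) =
      Φ (((2 * p).factorial / p.factorial * (-1) ^ p : ℂ) • Finsupp.single p (1 : ℂ)) := by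
    intro p
    funext x'
    simp only [sphericalVector_iotaN, norm_slice_sq, ← add_assoc]
    rw [iteratedDeriv_add_sq_cpow (by positivity), map_smul, hΦ, Finsupp.linearCombination_single]
    simp only [japaneseFam, japanesePow, Pi.smul_apply, smul_eq_mul]
    ring
  have hterm : ∀ q ∈ Finset.HasAntidiagonal.antidiagonal l,
      (2 : ℂ) ^ (2 * l - 2 * q.2) *
        (∏ i ∈ Finset.Icc 1 (l - q.2), ((lam + nu - m - 2) / 2 + i)) /
        (Nat.factorial q.2 * Nat.factorial (2 * l - 2 * q.2)) *
      (Laplacian.laplacian : (E m → ℂ) → E m → ℂ)^[q.2]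
        (fun x' => iteratedDeriv (2 * l - 2 * q.2)
          (fun s : ℝ => (sphericalVector (m + 1) lam).1 (iotaN (slice x' s))) 0) x =
      (4 ^ l / l.factorial : ℂ) * Φ (l.choose q.1 •
        ((-1) ^ q.1 * (ascPochhammer ℂ q.1).eval b) •
          (quarterLaplacian c ^ q.2) (Finsupp.single (0 + q.1) 1)) x := by
    rintro ⟨p, j⟩ hq
    rw [Finset.HasAntidiagonal.mem_antidiagonal] at hq
    simp only at hq ⊢
    subst hq
    rw [show 2 * (p + j) - 2 * j = 2 * p by omega, Nat.add_sub_cancel, hinner,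
      iterate_laplacian_linearCombination_japaneseFam, prod_Icc_add_eq_ascPochhammer,
      show (lam + nu - m - 2) / 2 + 1 = b by rw [hnu, hb]; push_cast; ring]
    simp only [map_smul, map_nsmul, Pi.smul_apply, smul_eq_mul, nsmul_eq_mul, zero_add]
    rw [Nat.cast_add_choose]
    have h1 : (p.factorial : ℂ) ≠ 0 := by exact_mod_cast p.factorial_ne_zero
    have h2 : (j.factorial : ℂ) ≠ 0 := by exact_mod_cast j.factorial_ne_zero
    have h3 : ((2 * p).factorial : ℂ) ≠ 0 := by exact_mod_cast (2 * p).factorial_ne_zero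
    rw [pow_add, pow_mul, show (2 : ℂ) ^ 2 = 4 by norm_num]
    rw [← hc, ← hΦ]
    field_simp
  rw [diffOpC, ← Finset.Nat.sum_antidiagonal_eq_sum_range_succ_mk (n := l) (f := fun q =>
    (2 : ℂ) ^ (2 * l - 2 * q.1) *
        (∏ i ∈ Finset.Icc 1 (l - q.1), ((lam + nu - m - 2) / 2 + i)) /
        (Nat.factorial q.1 * Nat.factorial (2 * l - 2 * q.1)) *
      (Laplacian.laplacian : (E m → ℂ) → E m → ℂ)^[q.1]
        (fun x' => iteratedDeriv (2 * l - 2 * q.1)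
          (fun s : ℝ => (sphericalVector (m + 1) lam).1 (iotaN (slice x' s))) 0) x),
    ← Finset.Nat.sum_antidiagonal_swap]
  simp only [Prod.fst_swap]
  rw [Finset.sum_congr rfl hterm, ← Finset.mul_sum, ← Finset.sum_apply, ← map_sum,
    sum_choose_ascPochhammer_pow (quarterLaplacian c) (fun i => Finsupp.single i 1) c
      (fun i => by simp [quarterLaplacian]) l 0 b,
    Finset.Nat.sum_antidiagonal_eq_sum_range_succ_mk, Finset.sum_range_succ']
  -- For this `b` the falling factorials are evaluated at `0`, so every one of positive length
  -- vanishes and only `(-1)^l v₂ₗ` is left.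
  rw [Finset.sum_eq_zero fun q _ => by
    rw [show c + (0 : ℕ) + l - 1 - b = 0 by rw [hc, hb]; push_cast; ring,
      descPochhammer_eval_succ_left]
    simp]
  simp only [zero_add, Nat.choose_zero_right, tsub_zero, descPochhammer_zero, Polynomial.eval_one,
    mul_one, one_smul, add_zero, map_smul, Pi.smul_apply, smul_eq_mul, hΦ,
    Finsupp.linearCombination_single, japaneseFam]
  rw [hnu, pow_mul, show (2 : ℂ) ^ 2 = 4 by norm_num]
  push_cast
  ring

theorem opC_spherical {m l : ℕ} (hm : 1 ≤ m) (lam nu : ℂ) (hl : (l : ℂ) = (nu - lam) / 2) :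
    opC m l lam nu (sphericalVector (m + 1) lam) =
      ((-1) ^ l * 2 ^ (2 * l) * (ascPochhammer ℂ (2 * l)).eval lam / (Nat.factorial l : ℂ)) •
        sphericalVector m nu := by
  refine opC_eq hm fun x => ?_
  rw [diffOpC_spherical l lam nu (by rw [hl]; ring)]
  have := sphericalVector_iotaN nu x
  rw [japanesePow, ← this]
  rfl

/-! ### Integration in polar coordinates and Beta integrals -/

theorem ofReal_cpow_mul_cpow {r : ℝ} (hr : 0 < r) (a b : ℂ) :
    (r : ℂ) ^ a * (r : ℂ) ^ b = (r : ℂ) ^ (a + b) := by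
  rw [Complex.cpow_add]
  exact_mod_cast hr.ne'

/-- No integrability is assumed: the product formula for Bochner integrals holds unconditionally,
both sides being zero in the degenerate cases. -/
theorem integral_polar {F : Type*} [NormedAddCommGroup F] [NormedSpace ℝ F]
    [FiniteDimensional ℝ F] [Nontrivial F] [MeasurableSpace F] [BorelSpace F]
    (μ : Measure F) [μ.IsAddHaarMeasure] (h : F → ℂ) (f : Metric.sphere (0 : F) 1 → ℂ) (g : ℝ → ℂ)
    (hfg : ∀ (r : ℝ) (w : Metric.sphere (0 : F) 1), 0 < r → h (r • w.1) = f w * g r) :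
    ∫ x, h x ∂μ = (∫ w, f w ∂μ.toSphere) *
      ∫ r in Ioi (0 : ℝ), (r : ℂ) ^ (Module.finrank ℝ F - 1) * g r := by
  calc ∫ x, h x ∂μ = ∫ x : ({(0)}ᶜ : Set F), h x.1 ∂(μ.comap (↑)) := by
        rw [integral_subtype_comap (measurableSet_singleton _).compl h,
          restrict_compl_singleton]
    _ = ∫ x : Metric.sphere (0 : F) 1 × Ioi (0 : ℝ), f x.1 * g x.2
          ∂μ.toSphere.prod (.volumeIoiPow (Module.finrank ℝ F - 1)) := by
        rw [← μ.measurePreserving_homeomorphUnitSphereProd.symm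
          (homeomorphUnitSphereProd F).toMeasurableEquiv |>.integral_comp
          (homeomorphUnitSphereProd F).symm.measurableEmbedding]
        refine integral_congr_ae (Filter.Eventually.of_forall fun x => ?_)
        exact hfg x.2 x.1 x.2.2
    _ = (∫ w, f w ∂μ.toSphere) *
          ∫ r : Ioi (0 : ℝ), g r ∂(.volumeIoiPow (Module.finrank ℝ F - 1)) :=
        integral_prod_mul f (fun r : Ioi (0 : ℝ) => g r)
    _ = _ := by
        congr 1
        simp only [Measure.volumeIoiPow, ENNReal.ofReal]
        rw [integral_withDensity_eq_integral_smul,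
          integral_subtype_comap measurableSet_Ioi fun a ↦
            Real.toNNReal (a ^ (Module.finrank ℝ F - 1)) • g a,
          setIntegral_congr_fun measurableSet_Ioi fun x hx ↦ ?_]
        · simp only [NNReal.smul_def]
          rw [Real.coe_toNNReal _ (pow_nonneg (le_of_lt hx) _), Complex.real_smul,
            Complex.ofReal_pow]
        · exact (measurable_subtype_coe.pow_const _).real_toNNReal

theorem integral_Ioi_comp_sq (g : ℝ → ℂ) :
    ∫ r in Ioi (0 : ℝ), (2 * r : ℂ) * g (r ^ 2) = ∫ y in Ioi (0 : ℝ), g y := by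
  rw [← integral_comp_rpow_Ioi_of_pos (g := g) (p := 2) two_pos]
  refine setIntegral_congr_fun measurableSet_Ioi fun r _ => ?_
  norm_num

theorem integral_cpow_mul_exp_neg_sq {s : ℂ} (hs : 0 < s.re) :
    ∫ r in Ioi (0 : ℝ), (r : ℂ) ^ (s - 1) * Complex.exp (-(r : ℂ) ^ 2) =
      Complex.Gamma (s / 2) / 2 := by
  have hs2 : 0 < (s / 2).re := by
    rw [Complex.div_ofNat_re]; positivity
  rw [Complex.Gamma_eq_integral hs2, Complex.GammaIntegral,
    ← integral_Ioi_comp_sq fun x => (Real.exp (-x) : ℂ) * (x : ℂ) ^ (s / 2 - 1),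
    ← integral_div]
  refine setIntegral_congr_fun measurableSet_Ioi fun r hr => ?_
  have hr' : (r : ℂ) ≠ 0 := by exact_mod_cast (ne_of_gt hr)
  have h1 : ((r ^ 2 : ℝ) : ℂ) ^ (s / 2 - 1) = (r : ℂ) ^ (s - 2) := by
    rw [sq, Complex.ofReal_mul, Complex.mul_cpow_ofReal_nonneg (le_of_lt hr) (le_of_lt hr),
      ofReal_cpow_mul_cpow hr]
    ring_nf
  have h2 : (r : ℂ) ^ (s - 1) = (r : ℂ) ^ (s - 2) * r := by
    rw [show s - 1 = (s - 2) + 1 by ring, Complex.cpow_add _ _ hr', Complex.cpow_one]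
  rw [h1, h2]
  push_cast
  ring

/-- The substitution `y = t / (1 - t)` turns this into the Beta integral over `(0, 1)`. -/
theorem integral_Ioi_beta {p q : ℂ} (hp : 0 < p.re) (hq : 0 < q.re) :
    ∫ y in Ioi (0 : ℝ), (y : ℂ) ^ (p - 1) * ((1 + y : ℝ) : ℂ) ^ (-(p + q)) =
      Complex.Gamma p * Complex.Gamma q / Complex.Gamma (p + q) := by
  rw [← Complex.betaIntegral_eq_Gamma_mul_div _ _ hp hq, Complex.betaIntegral,
    intervalIntegral.integral_of_le zero_le_one, integral_Ioc_eq_integral_Ioo]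
  have himg : (fun t : ℝ => t / (1 - t)) '' Ioo 0 1 = Ioi 0 := by
    ext y
    constructor
    · rintro ⟨t, ht, rfl⟩
      exact div_pos ht.1 (by linarith [ht.2])
    · intro hy
      have hy' : (0 : ℝ) < y := hy
      refine ⟨y / (1 + y), ⟨by positivity, (div_lt_one (by positivity)).mpr (by linarith)⟩, ?_⟩
      simp only
      field_simp
      ring
  have hinj : InjOn (fun t : ℝ => t / (1 - t)) (Ioo 0 1) := by
    intro s hs t ht hst
    have h1 : 1 - s ≠ 0 := by linarith [hs.2]
    have h2 : 1 - t ≠ 0 := by linarith [ht.2]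
    simp only at hst
    rw [div_eq_div_iff h1 h2] at hst
    linarith
  have hder : ∀ t ∈ Ioo (0 : ℝ) 1,
      HasDerivWithinAt (fun t : ℝ => t / (1 - t)) (1 / (1 - t) ^ 2) (Ioo 0 1) t := by
    intro t ht
    have h1 : 1 - t ≠ 0 := by linarith [ht.2]
    have := (hasDerivAt_id t).div ((hasDerivAt_id t).const_sub 1) h1
    refine (this.congr_deriv ?_).hasDerivWithinAt
    simp
  rw [← himg, integral_image_eq_integral_abs_deriv_smul measurableSet_Ioo hder hinj]
  refine setIntegral_congr_fun measurableSet_Ioo fun t ht => ?_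
  have h1 : 0 < 1 - t := by linarith [ht.2]
  have h1' : ((1 - t : ℝ) : ℂ) ≠ 0 := by exact_mod_cast h1.ne'
  have h2 : (1 + t / (1 - t) : ℝ) = (1 - t)⁻¹ := by field_simp; ring
  simp only [h2]
  rw [div_eq_mul_inv t, Complex.ofReal_mul,
    Complex.mul_cpow_ofReal_nonneg ht.1.le (inv_nonneg.mpr h1.le), Complex.real_smul,
    abs_of_pos (by positivity)]
  have h3 : (((1 - t)⁻¹ : ℝ) : ℂ) ^ (p - 1) * (((1 - t)⁻¹ : ℝ) : ℂ) ^ (-(p + q)) =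
      (((1 - t) ^ 2 : ℝ) : ℂ) * ((1 - t : ℝ) : ℂ) ^ (q - 1) := by
    rw [ofReal_cpow_mul_cpow (by positivity), Complex.ofReal_inv, Complex.inv_cpow,
      ← Complex.cpow_neg, show -(p - 1 + -(p + q)) = 2 + (q - 1) by ring,
      Complex.cpow_add _ _ h1', Complex.cpow_ofNat, Complex.ofReal_pow]
    rw [Complex.arg_ofReal_of_nonneg h1.le]
    exact Real.pi_pos.ne
  rw [mul_assoc, h3]
  have h4 : (1 - (t : ℂ)) ≠ 0 := by simpa using h1'
  push_cast
  field_simp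

theorem integral_cpow_mul_one_add_sq_cpow {p q : ℂ} (hp : 0 < p.re) (hq : 0 < q.re) :
    ∫ r in Ioi (0 : ℝ), (r : ℂ) ^ (2 * p - 1) * ((1 + r ^ 2 : ℝ) : ℂ) ^ (-(p + q)) =
      Complex.Gamma p * Complex.Gamma q / Complex.Gamma (p + q) / 2 := by
  rw [← integral_Ioi_beta hp hq, ← integral_Ioi_comp_sq fun y =>
    (y : ℂ) ^ (p - 1) * ((1 + y : ℝ) : ℂ) ^ (-(p + q)), ← integral_div]
  refine setIntegral_congr_fun measurableSet_Ioi fun r hr => ?_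
  have hr' : (r : ℂ) ≠ 0 := by exact_mod_cast (ne_of_gt hr)
  have h1 : ((r ^ 2 : ℝ) : ℂ) ^ (p - 1) = (r : ℂ) ^ (2 * p - 2) := by
    rw [sq, Complex.ofReal_mul, Complex.mul_cpow_ofReal_nonneg (le_of_lt hr) (le_of_lt hr),
      ofReal_cpow_mul_cpow hr]
    ring_nf
  have h2 : (r : ℂ) ^ (2 * p - 1) = (r : ℂ) ^ (2 * p - 2) * r := by
    rw [show 2 * p - 1 = (2 * p - 2) + 1 by ring, Complex.cpow_add _ _ hr', Complex.cpow_one]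
  rw [h1, h2]
  ring

theorem integral_comp_abs_complex (f : ℝ → ℂ) :
    ∫ x, f |x| = 2 * ∫ x in Ioi (0 : ℝ), f x := by
  have := integral_fun_norm_addHaar (volume : Measure ℝ) f
  simpa [Measure.real, Real.volume_ball, ENNReal.toReal_ofReal] using this

theorem integral_abs_cpow_mul_exp_neg_sq {a : ℂ} (ha : -1 < a.re) :
    ∫ x : ℝ, ((|x| : ℝ) : ℂ) ^ a * Complex.exp (-(x : ℂ) ^ 2) = Complex.Gamma ((a + 1) / 2) := by
  have h := integral_cpow_mul_exp_neg_sq (s := a + 1) (by simp; linarith)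
  have h2 := integral_comp_abs_complex fun x => (x : ℂ) ^ a * Complex.exp (-(x : ℂ) ^ 2)
  rw [add_sub_cancel_right] at h
  rw [h, mul_div_cancel₀ _ two_ne_zero] at h2
  rw [← h2]
  refine integral_congr_ae (Filter.Eventually.of_forall fun x => ?_)
  simp only [← Complex.ofReal_pow, sq_abs]

theorem integral_last_cpow_mul_exp_neg_norm_sq {m : ℕ} {a : ℂ} (ha : -1 < a.re) :
    ∫ y : E (m + 1), ((|y (Fin.last m)| : ℝ) : ℂ) ^ a * Complex.exp (-(‖y‖ : ℂ) ^ 2) =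
      Complex.Gamma ((a + 1) / 2) * (Real.pi : ℂ) ^ ((m : ℂ) / 2) := by
  have hG : ∫ x : ℝ, Complex.exp (-(x : ℂ) ^ 2) = (Real.pi : ℂ) ^ ((1 : ℂ) / 2) := by
    have := integral_abs_cpow_mul_exp_neg_sq (a := 0) (by simp)
    simp only [Complex.cpow_zero, one_mul, zero_add, Complex.Gamma_one_half_eq] at this
    exact this
  have h := integral_fintype_prod_volume_eq_prod (ι := Fin (m + 1)) (E := fun _ => ℝ) (𝕜 := ℂ)
    (Fin.snoc (α := fun _ => ℝ → ℂ) (fun _ : Fin m => fun x : ℝ => Complex.exp (-(x : ℂ) ^ 2))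
      (fun x : ℝ => ((|x| : ℝ) : ℂ) ^ a * Complex.exp (-(x : ℂ) ^ 2)))
  rw [Fin.prod_univ_castSucc] at h
  simp only [Fin.snoc_castSucc, Fin.snoc_last, Finset.prod_const, Finset.card_univ,
    Fintype.card_fin] at h
  rw [integral_abs_cpow_mul_exp_neg_sq ha, hG, ← Complex.cpow_nat_mul] at h
  rw [mul_comm (Complex.Gamma _), show (m : ℂ) / 2 = m * (1 / 2) by ring, ← h,
    ← (PiLp.volume_preserving_toLp (Fin (m + 1))).integral_comp
      (MeasurableEquiv.toLp 2 _).measurableEmbedding]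
  refine integral_congr_ae (Filter.Eventually.of_forall fun x => ?_)
  simp only [Fin.prod_univ_castSucc, Fin.snoc_castSucc, Fin.snoc_last]
  rw [← Complex.ofReal_pow, EuclideanSpace.real_norm_sq_eq, Fin.sum_univ_castSucc,
    ← Complex.exp_sum]
  push_cast
  rw [mul_left_comm, ← Complex.exp_add, neg_add, Finset.sum_neg_distrib]

/-- The Gaussian integral of `|yₙ|^a` is computed twice: as a product over the coordinates and in
polar coordinates. The quotient by the radial factor is the sphere integral. -/
theorem integral_sphere_last_cpow {m : ℕ} {a : ℂ} (ha : -1 < a.re) :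
    ∫ w : Metric.sphere (0 : E (m + 1)) 1, ((|w.1 (Fin.last m)| : ℝ) : ℂ) ^ a
        ∂(volume : Measure (E (m + 1))).toSphere =
      2 * (Real.pi : ℂ) ^ ((m : ℂ) / 2) * Complex.Gamma ((a + 1) / 2) /
        Complex.Gamma ((a + m + 1) / 2) := by
  have h := integral_polar (volume : Measure (E (m + 1)))
    (fun y => ((|y (Fin.last m)| : ℝ) : ℂ) ^ a * Complex.exp (-(‖y‖ : ℂ) ^ 2))
    (fun w : Metric.sphere (0 : E (m + 1)) 1 => ((|w.1 (Fin.last m)| : ℝ) : ℂ) ^ a)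
    (fun r => (r : ℂ) ^ a * Complex.exp (-(r : ℂ) ^ 2)) (fun r w hr => by
      have hw : ‖w.1‖ = 1 := by simp
      simp only [PiLp.smul_apply, smul_eq_mul, abs_mul, Complex.ofReal_mul, norm_smul, hw,
        mul_one, Real.norm_eq_abs,
        abs_of_pos hr, Complex.mul_cpow_ofReal_nonneg hr.le (abs_nonneg _)]
      ring)
  have hm0 : (0 : ℝ) ≤ m := m.cast_nonneg
  have hG : Complex.Gamma ((a + m + 1) / 2) ≠ 0 := by
    apply Complex.Gamma_ne_zero_of_re_pos
    rw [Complex.div_ofNat_re]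
    simp
    linarith
  have h2 := integral_cpow_mul_exp_neg_sq (s := a + m + 1) (by simp; linarith)
  rw [integral_last_cpow_mul_exp_neg_norm_sq ha] at h
  have h3 : ∫ r in Ioi (0 : ℝ), (r : ℂ) ^ (Module.finrank ℝ (E (m + 1)) - 1) *
      ((r : ℂ) ^ a * Complex.exp (-(r : ℂ) ^ 2)) =
      ∫ r in Ioi (0 : ℝ), (r : ℂ) ^ (a + m + 1 - 1) * Complex.exp (-(r : ℂ) ^ 2) := by
    refine setIntegral_congr_fun measurableSet_Ioi fun r hr => ?_
    simp only [finrank_euclideanSpace, Fintype.card_fin, Nat.add_sub_cancel]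
    rw [← Complex.cpow_natCast, ← mul_assoc, ofReal_cpow_mul_cpow hr]
    ring_nf
  rw [h3, h2] at h
  rw [eq_div_iff hG]
  linear_combination -2 * h

/-! ### The regular operators on the spherical vector -/

theorem integral_kernel_zero {m : ℕ} {lam nu : ℂ} (h1 : 0 < (lam - nu).re)
    (h2 : (m : ℝ) < (lam + nu).re) :
    ∫ y : E (m + 1), ((|y (Fin.last m)| : ℝ) : ℂ) ^ (lam + nu - (m + 1)) *
        ((‖y‖ ^ 2 : ℝ) : ℂ) ^ (-nu) * ((1 + ‖y‖ ^ 2 : ℝ) : ℂ) ^ (-lam) =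
      Complex.Gamma ((lam + nu - m) / 2) * Complex.Gamma ((lam - nu) / 2) *
        ((Real.pi : ℂ) ^ ((m : ℂ) / 2) / Complex.Gamma lam) := by
  have hm0 : (0 : ℝ) ≤ m := m.cast_nonneg
  rw [integral_polar volume _
    (fun w : Metric.sphere (0 : E (m + 1)) 1 =>
      ((|w.1 (Fin.last m)| : ℝ) : ℂ) ^ (lam + nu - (m + 1)))
    (fun r => (r : ℂ) ^ (lam + nu - (m + 1)) * ((r : ℂ) ^ (-2 * nu) *
      ((1 + r ^ 2 : ℝ) : ℂ) ^ (-lam))) (fun r w hr => by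
      have hw : ‖w.1‖ = 1 := by simp
      simp only [PiLp.smul_apply, smul_eq_mul, abs_mul, Complex.ofReal_mul, norm_smul, hw,
        mul_one, Real.norm_eq_abs,
        abs_of_pos hr, Complex.mul_cpow_ofReal_nonneg hr.le (abs_nonneg _)]
      rw [show ((r ^ 2 : ℝ) : ℂ) ^ (-nu) = (r : ℂ) ^ (-2 * nu) by
        rw [sq, Complex.ofReal_mul, Complex.mul_cpow_ofReal_nonneg hr.le hr.le,
          ofReal_cpow_mul_cpow hr]
        ring_nf]
      ring), integral_sphere_last_cpow (by simp at h2 ⊢; linarith)]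
  have hp : 0 < ((lam - nu) / 2).re := by rw [Complex.div_ofNat_re]; positivity
  have hq : 0 < ((lam + nu) / 2).re := by
    rw [Complex.div_ofNat_re]
    linarith
  have h3 : ∫ r in Ioi (0 : ℝ), (r : ℂ) ^ (Module.finrank ℝ (E (m + 1)) - 1) *
      ((r : ℂ) ^ (lam + nu - (m + 1)) * ((r : ℂ) ^ (-2 * nu) *
      ((1 + r ^ 2 : ℝ) : ℂ) ^ (-lam))) =
      ∫ r in Ioi (0 : ℝ), (r : ℂ) ^ (2 * ((lam - nu) / 2) - 1) *
        ((1 + r ^ 2 : ℝ) : ℂ) ^ (-((lam - nu) / 2 + (lam + nu) / 2)) := by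
    refine setIntegral_congr_fun measurableSet_Ioi fun r hr => ?_
    simp only [finrank_euclideanSpace, Fintype.card_fin, Nat.add_sub_cancel]
    rw [← Complex.cpow_natCast, ← mul_assoc, ← mul_assoc, ofReal_cpow_mul_cpow hr,
      ofReal_cpow_mul_cpow hr]
    ring_nf
  rw [h3, integral_cpow_mul_one_add_sq_cpow hp hq,
    show (lam - nu) / 2 + (lam + nu) / 2 = lam by ring,
    show (lam + nu - (m + 1) + 1) / 2 = (lam + nu - m) / 2 by ring,
    show (lam + nu - (m + 1) + m + 1) / 2 = (lam + nu) / 2 by ring]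
  -- `Γ((λ + ν) / 2)` is in the denominator of the sphere integral and in the numerator of the Beta
  -- integral.
  have hG := Complex.Gamma_ne_zero_of_re_pos hq
  field_simp

/-- The derivative of an inversion is `(R / dist y c)²` times a reflection, whose determinant is
`±1` because it squares to the identity. The centre is a null set. -/
theorem integral_comp_inversion {F : Type*} [NormedAddCommGroup F] [InnerProductSpace ℝ F]
    [FiniteDimensional ℝ F] [Nontrivial F] [MeasurableSpace F] [BorelSpace F] (c : F) {R : ℝ}
    (hR : R ≠ 0) (g : F → ℂ) :
    ∫ y, g y = ∫ y, ((((R / dist y c) ^ 2) ^ Module.finrank ℝ F : ℝ) : ℂ) *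
      g (EuclideanGeometry.inversion c R y) := by
  have himg : EuclideanGeometry.inversion c R '' {c}ᶜ = {c}ᶜ := by
    rw [image_compl_eq (EuclideanGeometry.inversion_bijective c hR)]
    simp
  have hdet : ∀ K : Submodule ℝ F, |LinearMap.det (K.reflection : F →ₗ[ℝ] F)| = 1 := by
    intro K
    have h : (K.reflection : F →ₗ[ℝ] F) * (K.reflection : F →ₗ[ℝ] F) = 1 := by
      ext v
      simp
    have h2 := congrArg LinearMap.det h
    rw [map_mul, map_one] at h2
    have : |LinearMap.det (K.reflection : F →ₗ[ℝ] F)| ^ 2 = 1 := by rw [sq_abs, sq, h2]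
    nlinarith [abs_nonneg (LinearMap.det (K.reflection : F →ₗ[ℝ] F))]
  have key := integral_image_eq_integral_abs_det_fderiv_smul (volume : Measure F)
    (measurableSet_singleton c).compl
    (fun y hy => (EuclideanGeometry.hasFDerivAt_inversion (R := R) hy).hasFDerivWithinAt)
    (EuclideanGeometry.inversion_injective c hR).injOn g
  rw [himg, restrict_compl_singleton] at key
  rw [key]
  refine integral_congr_ae (Filter.Eventually.of_forall fun y => ?_)
  simp only
  rw [Complex.real_smul]
  congr 2
  change |LinearMap.det ((R / dist y c) ^ 2 • ((ℝ ∙ (y - c))ᗮ.reflection : F →ₗ[ℝ] F))| = _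
  rw [LinearMap.det_smul, abs_mul, hdet, mul_one, abs_of_nonneg (by positivity)]

/-- This is equivariance under the maximal compact subgroup made explicit: a suitable inversion
moves the base point from `x` to `0`. It is a pure change of variables, so no convergence condition
is needed. -/
theorem integral_kernel {m : ℕ} {lam nu : ℂ} (x : E m) :
    ∫ y : E (m + 1), ((|y (Fin.last m)| : ℝ) : ℂ) ^ (lam + nu - (m + 1)) *
        ((‖y - slice x 0‖ ^ 2 : ℝ) : ℂ) ^ (-nu) * ((1 + ‖y‖ ^ 2 : ℝ) : ℂ) ^ (-lam) =
      ((1 + ‖x‖ ^ 2 : ℝ) : ℂ) ^ (-nu) *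
        ∫ y : E (m + 1), ((|y (Fin.last m)| : ℝ) : ℂ) ^ (lam + nu - (m + 1)) *
        ((‖y‖ ^ 2 : ℝ) : ℂ) ^ (-nu) * ((1 + ‖y‖ ^ 2 : ℝ) : ℂ) ^ (-lam) := by
  have hX : ‖slice x 0‖ ^ 2 = ‖x‖ ^ 2 := by simp [norm_slice_sq]
  have hXl : (slice x 0 : E (m + 1)) (Fin.last m) = 0 := by simp [slice]
  set X : E (m + 1) := slice x 0
  rcases eq_or_ne X 0 with h0 | h0
  · rw [← hX, h0]
    simp
  have hXn : 0 < ‖X‖ ^ 2 := by positivity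
  set N : ℝ := ‖X‖ ^ 2 with hN
  -- The choice `R² = 1 + |c|²` makes the inversion multiply `1 + |y|²` by the conformal factor `ρ`.
  -- The centre on the line through `X` is the one for which `0` and `X` are exchanged, and `cₙ = 0`
  -- gives `|yₙ| ↦ ρ |yₙ|`.
  set c : E (m + 1) := -(N⁻¹ • X) with hc
  set R : ℝ := √(1 + N⁻¹) with hR
  have hR2 : R ^ 2 = 1 + N⁻¹ := Real.sq_sqrt (by positivity)
  have hR0 : R ≠ 0 := (Real.sqrt_pos.mpr (by positivity)).ne'
  rw [integral_comp_inversion c hR0, ← integral_const_mul]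
  refine integral_congr_ae ?_
  have hne : ∀ᵐ y : E (m + 1), y ≠ c := by
    rw [ae_iff]
    simp
  filter_upwards [hne] with y hy
  have hd : 0 < dist y c := dist_pos.mpr hy
  set ρ : ℝ := (R / dist y c) ^ 2 with hρ
  have hρ0 : 0 < ρ := by positivity
  have hρd : ρ * ‖y - c‖ ^ 2 = 1 + N⁻¹ := by
    rw [hρ, div_pow, hR2, dist_eq_norm] at *
    field_simp
  have hcl : c (Fin.last m) = 0 := by simp [hc, hXl]
  have hcN : ‖c‖ ^ 2 = N⁻¹ := by
    rw [hc, norm_neg, norm_smul, mul_pow, ← hN, Real.norm_eq_abs, sq_abs]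
    field_simp
  have hσ : EuclideanGeometry.inversion c R y = ρ • (y - c) + c := rfl
  rw [hσ, finrank_euclideanSpace, Fintype.card_fin]
  have e1 : |(ρ • (y - c) + c : E (m + 1)) (Fin.last m)| = ρ * |y (Fin.last m)| := by
    simp [hcl, abs_mul, abs_of_pos hρ0]
  have hyc : ‖y - c‖ ^ 2 = ‖y‖ ^ 2 - 2 * ⟪y, c⟫_ℝ + N⁻¹ := by
    rw [norm_sub_sq_real, hcN]
  have hin : ⟪y - c, c⟫_ℝ = ⟪y, c⟫_ℝ - N⁻¹ := by
    rw [inner_sub_left, real_inner_self_eq_norm_sq, hcN]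
  have e2 : 1 + ‖ρ • (y - c) + c‖ ^ 2 = ρ * (1 + ‖y‖ ^ 2) := by
    rw [norm_add_sq_real, norm_smul, real_inner_smul_left, mul_pow, Real.norm_eq_abs, sq_abs, hin,
      hcN, sq ρ, mul_assoc ρ ρ, hρd]
    have : 1 + N⁻¹ = ρ * (‖y‖ ^ 2 - 2 * ⟪y, c⟫_ℝ + N⁻¹) := by rw [← hyc, hρd]
    linear_combination this
  have hXc : X = -(N • c) := by
    rw [hc, smul_neg, neg_neg, smul_smul, mul_inv_cancel₀ hXn.ne', one_smul]
  have e3 : ‖ρ • (y - c) + c - X‖ ^ 2 = ρ * ((1 + N) * ‖y‖ ^ 2) := by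
    have h4 : ρ • (y - c) + c - X = ρ • (y - c) + (1 + N) • c := by
      rw [hXc]
      module
    rw [h4, norm_add_sq_real, norm_smul, norm_smul, real_inner_smul_left, real_inner_smul_right,
      mul_pow, mul_pow, Real.norm_eq_abs, Real.norm_eq_abs, sq_abs, sq_abs, hin, hcN, sq ρ,
      mul_assoc ρ ρ, hρd]
    have h5 : 1 + N⁻¹ = ρ * (‖y‖ ^ 2 - 2 * ⟪y, c⟫_ℝ + N⁻¹) := by rw [← hyc, hρd]
    have h6 : N * N⁻¹ = 1 := mul_inv_cancel₀ hXn.ne'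
    linear_combination (1 + N) * h5 + (1 + N) * h6 - ρ * h6
  rw [e1, e2, e3, ← hX, Complex.ofReal_mul ρ, Complex.ofReal_mul ρ, Complex.ofReal_mul ρ,
    Complex.ofReal_mul (1 + N),
    Complex.mul_cpow_ofReal_nonneg hρ0.le (abs_nonneg _),
    Complex.mul_cpow_ofReal_nonneg hρ0.le (by positivity), ← Complex.ofReal_mul (1 + N),
    Complex.mul_cpow_ofReal_nonneg hρ0.le (by positivity), Complex.ofReal_mul (1 + N),
    Complex.mul_cpow_ofReal_nonneg (by positivity) (by positivity)]
  -- The exponents of `ρ` from the Jacobian and the three factors of the integrand add up to zero.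
  have e4 : ((ρ ^ (m + 1) : ℝ) : ℂ) * ((ρ : ℂ) ^ (lam + nu - (m + 1)) * (ρ : ℂ) ^ (-nu) *
      (ρ : ℂ) ^ (-lam)) = 1 := by
    rw [Complex.ofReal_pow, ← Complex.cpow_natCast, ofReal_cpow_mul_cpow hρ0,
      ofReal_cpow_mul_cpow hρ0, ofReal_cpow_mul_cpow hρ0]
    push_cast
    ring_nf
    simp
  linear_combination (((1 + N : ℝ) : ℂ) ^ (-nu) *
    (((|y (Fin.last m)| : ℝ) : ℂ) ^ (lam + nu - (m + 1)) *
        ((‖y‖ ^ 2 : ℝ) : ℂ) ^ (-nu) * ((1 + ‖y‖ ^ 2 : ℝ) : ℂ) ^ (-lam))) * e4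

theorem differentiable_sphericalVector_apply {n : ℕ} (η : Cone n) :
    Differentiable ℂ fun nu : ℂ => (sphericalVector n nu).1 η := by
  have h0 : ((|η.1.2| : ℝ) : ℂ) ≠ 0 := by exact_mod_cast abs_ne_zero.mpr η.2.2
  exact fun z => (differentiableAt_id.neg).const_cpow (Or.inl h0)

theorem isFamilyA_spherical (m : ℕ) (lam : ℂ) :
    IsFamilyA (m := m) (sphericalVector (m + 1) lam) fun lam' nu' =>
      ((Real.pi : ℂ) ^ ((m : ℂ) / 2) / Complex.Gamma lam') • sphericalVector m nu' := by
  constructor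
  · intro η
    -- `Complex.Gamma` has the value `0` at its poles, so its inverse in Lean is the entire function
    -- `1/Γ` there too.
    have h1 : Differentiable ℂ fun p : ℂ × ℂ => (Complex.Gamma p.1)⁻¹ :=
      Complex.differentiable_one_div_Gamma.comp differentiable_fst
    have h2 := (differentiable_sphericalVector_apply η).comp
      (differentiable_snd : Differentiable ℂ fun p : ℂ × ℂ => p.2)
    exact (h1.const_mul ((Real.pi : ℂ) ^ ((m : ℂ) / 2))).mul h2
  · intro lam' nu' h1 h2 x
    rw [transport_sphericalVector]
    have hl : ∀ y : E (m + 1), (y - slice x 0) (Fin.last m) = y (Fin.last m) := by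
      simp [slice]
    have hA : Complex.Gamma ((lam' + nu' - m) / 2) ≠ 0 := by
      apply Complex.Gamma_ne_zero_of_re_pos
      rw [Complex.div_ofNat_re]
      simp at h2 ⊢
      linarith
    have hB : Complex.Gamma ((lam' - nu') / 2) ≠ 0 := by
      apply Complex.Gamma_ne_zero_of_re_pos
      rw [Complex.div_ofNat_re]
      positivity
    simp only [kernelA, sphericalVector_iotaN, hl, mul_assoc]
    rw [integral_const_mul]
    simp only [← mul_assoc]
    rw [integral_kernel, integral_kernel_zero h1 h2]
    change (_ / _) * (sphericalVector m nu').1 (iotaN x) = _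
    rw [sphericalVector_iotaN]
    field_simp

theorem opA_spherical {m : ℕ} (hm : 1 ≤ m) (lam nu : ℂ) :
    opA m lam nu (sphericalVector (m + 1) lam) =
      ((Real.pi : ℂ) ^ ((m : ℂ) / 2) / Complex.Gamma lam) • sphericalVector m nu :=
  (isFamilyA_spherical m lam).opA_eq hm nu

/-! ### Derivatives of zonal powers

A finitely supported family `p` of coefficients stands for the function
`∑ i, p i * (1 - t) ^ (-(nu + i))` of the variable `t < 1`. -/

section Zonal

variable (nu : ℂ)

/-- The function with the coefficients `p`. -/
def zonalFun (t : ℝ) : (ℕ →₀ ℂ) →ₗ[ℂ] ℂ :=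
  Finsupp.linearCombination ℂ fun i : ℕ => ((1 - t : ℝ) : ℂ) ^ (-(nu + i))

/-- The derivative `d/dt` on coefficients. -/
def zonalDeriv : Module.End ℂ (ℕ →₀ ℂ) :=
  Finsupp.linearCombination ℂ fun i : ℕ => (nu + i) • Finsupp.single (i + 1) (1 : ℂ)

/-- The Euler operator `t d/dt` on coefficients. -/
def zonalEuler : Module.End ℂ (ℕ →₀ ℂ) :=
  Finsupp.linearCombination ℂ fun i : ℕ =>
    (nu + i) • (Finsupp.single (i + 1) (1 : ℂ) - Finsupp.single i 1)

theorem zonalDeriv_single (i : ℕ) (a : ℂ) :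
    zonalDeriv nu (Finsupp.single i a) = (a * (nu + i)) • Finsupp.single (i + 1) (1 : ℂ) := by
  rw [zonalDeriv, Finsupp.linearCombination_single, smul_smul]

theorem zonalEuler_single (i : ℕ) (a : ℂ) :
    zonalEuler nu (Finsupp.single i a) =
      (a * (nu + i)) • (Finsupp.single (i + 1) (1 : ℂ) - Finsupp.single i 1) := by
  rw [zonalEuler, Finsupp.linearCombination_single, smul_smul]

theorem zonalDeriv_sq_mul_zonalEuler :
    zonalDeriv nu ^ 2 * zonalEuler nu =
      (zonalEuler nu + algebraMap ℂ _ 2) * zonalDeriv nu ^ 2 := by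
  refine Finsupp.lhom_ext' fun i => LinearMap.ext_ring ?_
  simp only [LinearMap.comp_apply, Finsupp.lsingle_apply, sq, Module.End.mul_apply,
    LinearMap.add_apply, Module.algebraMap_end_apply, zonalDeriv_single, zonalEuler_single,
    map_smul, map_sub]
  push_cast
  module

/-- `d²/dt²` lowers the degree by two, so moving it past the Euler operator shifts the latter by
`2`. -/
theorem zonalDeriv_sq_mul_aeval (p : Polynomial ℂ) :
    zonalDeriv nu ^ 2 * Polynomial.aeval (zonalEuler nu) p =
      Polynomial.aeval (zonalEuler nu) (p.comp (Polynomial.X + Polynomial.C 2)) *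
        zonalDeriv nu ^ 2 := by
  rw [Polynomial.aeval_comp]
  simp only [map_add, Polynomial.aeval_X, Polynomial.aeval_C]
  induction p using Polynomial.induction_on' with
  | add p q hp hq => simp only [map_add, mul_add, add_mul, hp, hq]
  | monomial n a =>
    rw [Polynomial.aeval_monomial, Polynomial.aeval_monomial]
    have h : ∀ n : ℕ, zonalDeriv nu ^ 2 * zonalEuler nu ^ n =
        (zonalEuler nu + algebraMap ℂ _ 2) ^ n * zonalDeriv nu ^ 2 := by
      intro n
      induction n with
      | zero => simp
      | succ n ih =>
        rw [pow_succ (zonalEuler nu), ← mul_assoc, ih, mul_assoc, zonalDeriv_sq_mul_zonalEuler,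
          ← mul_assoc,
          ← pow_succ]
    rw [← mul_assoc, ← Algebra.commutes, mul_assoc, h, mul_assoc]

/-- The polynomials `∏_{i < j} (i - α - X / 2)`. -/
def radialPoly (α : ℂ) (j : ℕ) : Polynomial ℂ :=
  ∏ i ∈ Finset.range j, (Polynomial.C ((i : ℂ) - α) - Polynomial.C (1 / 2) * Polynomial.X)

/-- The coefficients of the `j`-th derivative of `(1 - u) ^ α (1 - √(1 - u) t) ^ (-nu)` with
respect to `u`, at `u = 0`. -/
def radialCoeff (α : ℂ) (j : ℕ) : ℕ →₀ ℂ :=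
  Polynomial.aeval (zonalEuler nu) (radialPoly α j) (Finsupp.single 0 1)

theorem radialCoeff_succ (α : ℂ) (j : ℕ) :
    radialCoeff nu α (j + 1) =
      ((j : ℂ) - α) • radialCoeff nu α j - (1 / 2 : ℂ) • zonalEuler nu (radialCoeff nu α j) := by
  rw [radialCoeff, radialPoly, Finset.prod_range_succ, mul_comm, map_mul, ← radialPoly,
    Module.End.mul_apply, ← radialCoeff]
  simp [Module.algebraMap_end_apply]
  module

theorem zonalEuler_mem {j : ℕ} {p : ℕ →₀ ℂ} (hp : p ∈ Finsupp.supported ℂ ℂ (Iic j)) :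
    zonalEuler nu p ∈ Finsupp.supported ℂ ℂ (Iic (j + 1)) := by
  rw [zonalEuler, Finsupp.linearCombination_apply]
  refine Submodule.sum_mem _ fun i hi => ?_
  have hi' : i ≤ j := hp hi
  refine Submodule.smul_mem _ _ (Submodule.smul_mem _ _ (Submodule.sub_mem _ ?_ ?_))
  · exact Finsupp.single_mem_supported _ _ (by simpa using hi')
  · exact Finsupp.single_mem_supported _ _ (by simp; omega)

/-- Each Euler operator raises the exponent by at most one. This bound on the singularity at `t = 1`
is what lets the integral be taken termwise. -/
theorem radialCoeff_mem (α : ℂ) (j : ℕ) :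
    radialCoeff nu α j ∈ Finsupp.supported ℂ ℂ (Iic j) := by
  induction j with
  | zero => simpa [radialCoeff, radialPoly] using Finsupp.single_mem_supported ℂ (1 : ℂ) (by simp)
  | succ j ih =>
    rw [radialCoeff_succ]
    refine Submodule.sub_mem _ (Submodule.smul_mem _ _ ?_)
      (Submodule.smul_mem _ _ (zonalEuler_mem nu ih))
    exact Finsupp.supported_mono (Iic_subset_Iic.mpr j.le_succ) ih

/-- The operator `(1 - t²) d²/dt² - 2 μ t d/dt` on coefficients. -/
def gegenbauer (μ : ℂ) : Module.End ℂ (ℕ →₀ ℂ) :=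
  zonalDeriv nu ^ 2 - zonalEuler nu ^ 2 + (1 - 2 * μ) • zonalEuler nu

/-- The contributions of index `i + 2` cancel, so a functional killing the image of the operator has
moments obeying a two-term recurrence. -/
theorem gegenbauer_single (μ : ℂ) (i : ℕ) :
    gegenbauer nu μ (Finsupp.single i 1) =
      (nu + i) • ((2 * (nu + i + 1 - μ)) • Finsupp.single (i + 1) (1 : ℂ) -
        (nu + i + 1 - 2 * μ) • Finsupp.single i 1) := by
  simp only [gegenbauer, LinearMap.add_apply, LinearMap.sub_apply, LinearMap.smul_apply, sq,
    Module.End.mul_apply, zonalDeriv_single, zonalEuler_single, map_smul, map_sub]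
  push_cast
  module

/-- All terms become polynomials in the Euler operator applied to `(1 - t)^(-ν)`. Commuting `d²/dt²`
past the radial polynomial raises its parameter by one, and on `(1 - t)^(-ν)` itself `d²/dt²` equals
`(E + ν + 1)(E + ν)`, with `E` the Euler operator. The claim is then an identity of polynomials,
which follows by splitting off the first or the last factor of the radial polynomial. -/
theorem gegenbauer_radialCoeff (μ : ℂ) (j : ℕ) :
    gegenbauer nu μ (radialCoeff nu (μ - 1 / 2 - 1) j) =
      ((2 * j + nu - 2 * μ + 1) * (2 * j + nu - 2 * μ + 2)) • radialCoeff nu (μ - 1 / 2) j -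
        (4 * (j + nu - μ + 1)) • radialCoeff nu (μ - 1 / 2) (j + 1) := by
  have h0 : zonalDeriv nu ^ 2 * Polynomial.aeval (zonalEuler nu) (radialPoly (μ - 1 / 2 - 1) j) =
      Polynomial.aeval (zonalEuler nu) (radialPoly (μ - 1 / 2) j) * zonalDeriv nu ^ 2 := by
    rw [zonalDeriv_sq_mul_aeval]
    congr 2
    rw [radialPoly, radialPoly, Polynomial.prod_comp]
    refine Finset.prod_congr rfl fun i _ => ?_
    simp only [Polynomial.sub_comp, Polynomial.mul_comp, Polynomial.C_comp, Polynomial.X_comp]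
    rw [mul_add, ← Polynomial.C_mul, add_comm, ← sub_sub, ← Polynomial.C_sub]
    congr 2
    ring
  have h1 : (zonalDeriv nu ^ 2) (Finsupp.single 0 1) =
      Polynomial.aeval (zonalEuler nu) ((Polynomial.X + Polynomial.C (nu + 1)) *
        (Polynomial.X + Polynomial.C nu)) (Finsupp.single 0 1) := by
    simp only [map_mul, map_add, Polynomial.aeval_X, Polynomial.aeval_C, Module.End.mul_apply,
      LinearMap.add_apply, Module.algebraMap_end_apply, sq, zonalDeriv_single, zonalEuler_single,
      map_smul, map_sub]
    push_cast
    module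
  have h2 : radialPoly (μ - 1 / 2) (j + 1) = radialPoly (μ - 1 / 2 - 1) j *
      (Polynomial.C (-(μ - 1 / 2)) - Polynomial.C (1 / 2) * Polynomial.X) := by
    rw [radialPoly, radialPoly, Finset.prod_range_succ']
    congr 1
    · refine Finset.prod_congr rfl fun i _ => ?_
      congr 2
      push_cast
      ring
    · simp
  have h3 : radialPoly (μ - 1 / 2) (j + 1) = radialPoly (μ - 1 / 2) j *
      (Polynomial.C ((j : ℂ) - (μ - 1 / 2)) - Polynomial.C (1 / 2) * Polynomial.X) := by
    rw [radialPoly, Finset.prod_range_succ, ← radialPoly]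
  have h4 : radialPoly (μ - 1 / 2) j * ((Polynomial.X + Polynomial.C (nu + 1)) *
        (Polynomial.X + Polynomial.C nu)) -
      Polynomial.X ^ 2 * radialPoly (μ - 1 / 2 - 1) j +
        Polynomial.C (1 - 2 * μ) * (Polynomial.X * radialPoly (μ - 1 / 2 - 1) j) =
      Polynomial.C ((2 * j + nu - 2 * μ + 1) * (2 * j + nu - 2 * μ + 2)) *
        radialPoly (μ - 1 / 2) j -
      Polynomial.C (4 * (j + nu - μ + 1)) * radialPoly (μ - 1 / 2) (j + 1) := by
    have e := h2.symm.trans h3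
    apply Polynomial.funext
    intro z
    have e' := congrArg (Polynomial.eval z) e
    rw [h3]
    simp only [Polynomial.eval_add, Polynomial.eval_sub, Polynomial.eval_mul, Polynomial.eval_pow,
      Polynomial.eval_X, Polynomial.eval_C] at e' ⊢
    linear_combination (2 * z) * e'
  rw [gegenbauer]
  -- The scalars are made opaque so that the `map_*` lemmas do not expand them inside
  -- `Polynomial.C`.
  generalize (2 * j + nu - 2 * μ + 1) * (2 * j + nu - 2 * μ + 2) = A at h4 ⊢
  generalize 4 * (j + nu - μ + 1) = B at h4 ⊢
  generalize 1 - 2 * μ = C at h4 ⊢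
  have h5 := congrArg (fun q => Polynomial.aeval (zonalEuler nu) q (Finsupp.single 0 1)) h4
  simp only [map_add, map_sub, map_mul, map_pow, Polynomial.aeval_X, Polynomial.aeval_C,
    LinearMap.add_apply, LinearMap.sub_apply, Module.End.mul_apply,
    Module.algebraMap_end_apply] at h5
  simp only [radialCoeff, LinearMap.add_apply, LinearMap.sub_apply, LinearMap.smul_apply]
  rw [← Module.End.mul_apply (zonalDeriv nu ^ 2), h0, Module.End.mul_apply, h1]
  simp only [map_add, map_mul, Polynomial.aeval_X, Polynomial.aeval_C, Module.End.mul_apply,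
    LinearMap.add_apply, Module.algebraMap_end_apply]
  exact h5

/-- A functional with the moments of the Gegenbauer weight satisfies the hypergeometric
recurrence. -/
theorem functional_radialCoeff_succ {μ : ℂ} {I : (ℕ →₀ ℂ) →ₗ[ℂ] ℂ} {k : ℕ}
    (hI : ∀ i < k, 2 * (nu + i + 1 - μ) * I (Finsupp.single (i + 1) 1) =
      (nu + i + 1 - 2 * μ) * I (Finsupp.single i 1)) {j : ℕ} (hj : j < k) :
    4 * (j + nu - μ + 1) * I (radialCoeff nu (μ - 1 / 2) (j + 1)) =
      ((2 * j + nu - 2 * μ + 1) * (2 * j + nu - 2 * μ + 2)) *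
        I (radialCoeff nu (μ - 1 / 2) j) := by
  have h0 : ∀ p ∈ Finsupp.supported ℂ ℂ (Iic j), I (gegenbauer nu μ p) = 0 := by
    intro p hp
    conv_lhs => rw [← Finsupp.sum_single p, Finsupp.sum, map_sum, map_sum]
    refine Finset.sum_eq_zero fun i hi => ?_
    have hi' : i ≤ j := hp hi
    rw [← mul_one (p i), ← smul_eq_mul, ← Finsupp.smul_single, map_smul, map_smul,
      gegenbauer_single, map_smul, map_sub, map_smul, map_smul]
    simp only [smul_eq_mul]
    rw [hI i (by omega)]
    ring
  have h1 := h0 _ (radialCoeff_mem nu (μ - 1 / 2 - 1) j)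
  rw [gegenbauer_radialCoeff, map_sub, map_smul, map_smul, smul_eq_mul, smul_eq_mul] at h1
  linear_combination -h1

/-- The Beta-type moments satisfy the Gegenbauer moment recurrence by `Γ(z + 1) = z Γ(z)`. The
resulting recurrence in `j` is solved from the moment of index `0`; its leading coefficient is
nonzero by the condition on `Re (μ - ν - k)`. -/
theorem functional_radialCoeff {μ V : ℂ} {I : (ℕ →₀ ℂ) →ₗ[ℂ] ℂ} {k : ℕ} (hμ : 0 < μ.re)
    (hk : 0 < (μ - nu - k).re)
    (hI : ∀ i ≤ k, I (Finsupp.single i 1) = V * 2 ^ (2 * μ - 1 - (nu + i)) *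
      (Complex.Gamma (μ - (nu + i)) * Complex.Gamma μ / Complex.Gamma (2 * μ - (nu + i)))) :
    ∀ j ≤ k, I (radialCoeff nu (μ - 1 / 2) j) = V * (-1) ^ j * 2 ^ (2 * μ - 2 * j - nu - 1) *
      Complex.Gamma (μ - nu - j) * Complex.Gamma μ / Complex.Gamma (2 * μ - 2 * j - nu) := by
  have hre : ∀ i : ℕ, i ≤ k → 0 < (μ - nu - i).re := by
    intro i hi
    have : (i : ℝ) ≤ k := by exact_mod_cast hi
    simp at hk ⊢
    linarith
  have h2pow : ∀ s : ℂ, (2 : ℂ) ^ s = 2 * 2 ^ (s - 1) := by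
    intro s
    rw [Complex.cpow_sub _ _ two_ne_zero, Complex.cpow_one, mul_div_cancel₀ _ two_ne_zero]
  have hne : ∀ z : ℂ, 0 < z.re → z ≠ 0 := by
    rintro z hz rfl
    simp at hz
  have hrec : ∀ i < k, 2 * (nu + i + 1 - μ) * I (Finsupp.single (i + 1) 1) =
      (nu + i + 1 - 2 * μ) * I (Finsupp.single i 1) := by
    intro i hi
    have hx := hre (i + 1) hi
    have hy : 0 < (2 * μ - (nu + (i + 1 : ℕ))).re := by
      simp at hx ⊢
      linarith
    rw [hI i hi.le, hI (i + 1) hi,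
      show μ - (nu + i) = (μ - nu - (i + 1 : ℕ)) + 1 by push_cast; ring,
      show 2 * μ - (nu + i) = (2 * μ - (nu + (i + 1 : ℕ))) + 1 by push_cast; ring,
      Complex.Gamma_add_one _ (hne _ hx), Complex.Gamma_add_one _ (hne _ hy),
      h2pow (2 * μ - 1 - (nu + i)),
      show 2 * μ - 1 - (nu + i) - 1 = 2 * μ - 1 - (nu + (i + 1 : ℕ)) by push_cast; ring,
      show μ - (nu + (i + 1 : ℕ)) = μ - nu - (i + 1 : ℕ) by ring]
    have hG := Complex.Gamma_ne_zero_of_re_pos hy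
    have hy' := hne _ hy
    have : (nu + i + 1 - 2 * μ) = -(2 * μ - (nu + (i + 1 : ℕ))) := by push_cast; ring
    rw [this]
    field_simp
    push_cast
    ring
  intro j
  induction j with
  | zero =>
    intro _
    have h := hI 0 (Nat.zero_le k)
    simp only [radialCoeff, radialPoly, Finset.range_zero, Finset.prod_empty, map_one,
      Module.End.one_apply]
    rw [h]
    simp only [Nat.cast_zero, add_zero, pow_zero, mul_zero, sub_zero]
    rw [show 2 * μ - 1 - nu = 2 * μ - nu - 1 by ring]
    ring
  | succ j ih =>
    intro hj
    have h := functional_radialCoeff_succ nu hrec (show j < k from hj)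
    have hx := hre (j + 1) hj
    rw [ih (by omega), show μ - nu - j = (μ - nu - (j + 1 : ℕ)) + 1 by push_cast; ring,
      Complex.Gamma_add_one _ (hne _ hx), h2pow (2 * μ - 2 * j - nu - 1),
      h2pow (2 * μ - 2 * j - nu - 1 - 1)] at h
    have hn : 4 * (j + nu - μ + 1) ≠ 0 := by
      have := hne _ hx
      intro h0
      apply this
      push_cast
      linear_combination (-1 / 4) * h0
    apply mul_left_cancel₀ hn
    rw [h, show 2 * μ - 2 * j - nu - 1 - 1 - 1 = 2 * μ - 2 * (j + 1 : ℕ) - nu - 1 by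
      push_cast; ring]
    -- The argument of the Gamma function in the denominator may be a pole, so the functional
    -- equation is used for `1/Γ`, where it holds everywhere.
    simp only [div_eq_mul_inv]
    rw [Complex.one_div_Gamma_eq_self_mul_one_div_Gamma_add_one (2 * μ - 2 * (j + 1 : ℕ) - nu),
      Complex.one_div_Gamma_eq_self_mul_one_div_Gamma_add_one (2 * μ - 2 * (j + 1 : ℕ) - nu + 1),
      show 2 * μ - 2 * ((j + 1 : ℕ) : ℂ) - nu + 1 + 1 = 2 * μ - 2 * j - nu by push_cast; ring]
    push_cast
    ring

theorem hasDerivAt_zonalFun (p : ℕ →₀ ℂ) {t : ℝ} (ht : t < 1) :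
    HasDerivAt (fun t => zonalFun nu t p) (zonalFun nu t (zonalDeriv nu p)) t := by
  induction p using Finsupp.induction_linear with
  | zero => simpa using hasDerivAt_const t (0 : ℂ)
  | add f g hf hg => simp only [map_add]; exact hf.add hg
  | single i a =>
    have h1 := hasDerivAt_add_cpow (A := 1) (u := -t) (nu + i) (by linarith)
    have h2 := h1.scomp t (hasDerivAt_neg t)
    rw [zonalDeriv_single]
    simp only [zonalFun, Finsupp.linearCombination_single, map_smul, smul_eq_mul]
    refine (h2.const_mul a).congr_deriv ?_
    simp [sub_eq_add_neg, add_assoc]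
    ring

theorem mul_zonalFun_zonalDeriv (p : ℕ →₀ ℂ) {t : ℝ} (ht : t < 1) :
    t * zonalFun nu t (zonalDeriv nu p) = zonalFun nu t (zonalEuler nu p) := by
  induction p using Finsupp.induction_linear with
  | zero => simp
  | add f g hf hg => simp only [map_add, mul_add, hf, hg]
  | single i a =>
    have h0 : ((1 - t : ℝ) : ℂ) ≠ 0 := by
      have : 0 < 1 - t := by linarith
      exact_mod_cast this.ne'
    rw [zonalDeriv_single, zonalEuler_single]
    simp only [zonalFun, Finsupp.linearCombination_single, map_smul, map_sub, smul_eq_mul]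
    rw [show -(nu + (i : ℂ)) = 1 + -(nu + (i + 1 : ℕ)) by push_cast; ring,
      Complex.cpow_add _ _ h0, Complex.cpow_one]
    push_cast
    ring

/-- In the variable `u = s²`, differentiating `(1 - u)^(α-j) f(√(1-u) τ)` gives the same shape with
exponent `α - j - 1` and `f` replaced by `(j - α) f - (1/2) t f'`. For `|u| < 1 - τ²` the argument
of `f` stays below `1`. -/
theorem iteratedDeriv_zonal {τ : ℝ} (hτ : |τ| < 1) (α : ℂ) (k : ℕ) :
    iteratedDeriv (2 * k) (fun s : ℝ => ((1 - s ^ 2 : ℝ) : ℂ) ^ α *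
        ((1 - √(1 - s ^ 2) * τ : ℝ) : ℂ) ^ (-nu)) 0 =
      ((2 * k).factorial / k.factorial : ℂ) * zonalFun nu τ (radialCoeff nu α k) := by
  have hτ2 : τ ^ 2 < 1 := (sq_lt_one_iff_abs_lt_one τ).mpr hτ
  have hr : 0 < 1 - τ ^ 2 := by linarith
  have h := iteratedDeriv_comp_sq hr k (G := fun j u => ((1 - u : ℝ) : ℂ) ^ (α - j) *
    zonalFun nu (√(1 - u) * τ) (radialCoeff nu α j)) (fun j u hu => by
      rw [abs_lt] at hu
      have hu1 : 0 < 1 - u := by nlinarith [sq_nonneg τ]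
      have hσ : √(1 - u) * τ < 1 := by
        refine lt_of_abs_lt ?_
        rw [← sq_lt_one_iff_abs_lt_one, mul_pow, Real.sq_sqrt hu1.le]
        nlinarith [sq_nonneg τ, sq_nonneg (1 - τ ^ 2)]
      have hs0 : √(1 - u) ≠ 0 := (Real.sqrt_pos.mpr hu1).ne'
      have hd0 : HasDerivAt (fun u : ℝ => 1 - u) (-1) u := by
        simpa using (hasDerivAt_id u).const_sub 1
      have hd1 : HasDerivAt (fun u : ℝ => √(1 - u) * τ) (-1 / (2 * √(1 - u)) * τ) u :=
        (hd0.sqrt hu1.ne').mul_const τ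
      have hd2 := (hasDerivAt_zonalFun nu (radialCoeff nu α j) hσ).scomp u hd1
      have hd3 : HasDerivAt (fun u : ℝ => ((1 - u : ℝ) : ℂ) ^ (α - j))
          (-(α - j) * ((1 - u : ℝ) : ℂ) ^ (α - (j + 1 : ℕ))) u := by
        have h1 := hasDerivAt_add_cpow (A := 1) (u := -u) (-(α - j)) (by linarith)
        have h2 := h1.scomp u (hasDerivAt_neg u)
        simp only [neg_neg] at h2
        refine (h2.congr_deriv ?_)
        rw [← sub_eq_add_neg, show -(-(α - (j : ℂ)) + 1) = α - (j + 1 : ℕ) by push_cast; ring]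
        simp only [neg_smul, one_smul]
        ring
      refine (hd3.mul hd2).congr_deriv ?_
      have hu1' : ((1 - u : ℝ) : ℂ) ≠ 0 := by exact_mod_cast hu1.ne'
      have e1 : ((1 - u : ℝ) : ℂ) ^ (α - j) =
          ((1 - u : ℝ) : ℂ) ^ (α - (j + 1 : ℕ)) * ((1 - u : ℝ) : ℂ) := by
        rw [show α - (j : ℂ) = (α - (j + 1 : ℕ)) + 1 by push_cast; ring,
          Complex.cpow_add _ _ hu1', Complex.cpow_one]
      have e2 : ((1 - u : ℝ) : ℂ) * ((-1 / (2 * √(1 - u)) * τ : ℝ) : ℂ) =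
          -(1 / 2) * ((√(1 - u) * τ : ℝ) : ℂ) := by
        rw [← Complex.ofReal_mul]
        have : (1 - u) * (-1 / (2 * √(1 - u)) * τ) = -(1 / 2) * (√(1 - u) * τ) := by
          nth_rewrite 1 [← Real.sq_sqrt hu1.le]
          field_simp
        rw [this]
        push_cast
        ring
      rw [radialCoeff_succ, map_sub, map_smul, map_smul, ← mul_zonalFun_zonalDeriv nu _ hσ]
      simp only [Function.comp, smul_eq_mul, Complex.real_smul]
      rw [e1]
      linear_combination (((1 - u : ℝ) : ℂ) ^ (α - (j + 1 : ℕ)) *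
        zonalFun nu (√(1 - u) * τ) (zonalDeriv nu (radialCoeff nu α j))) * e2)
  have e : ∀ t : ℝ, zonalFun nu t (radialCoeff nu α 0) = ((1 - t : ℝ) : ℂ) ^ (-nu) := by
    intro t
    simp [radialCoeff, radialPoly, zonalFun]
  simp only [e, Nat.cast_zero, sub_zero] at h
  rw [h]
  simp

end Zonal

/-! ### Integrals of zonal functions over the sphere -/

theorem map_val_volumeIoiPow (n : ℕ) :
    (Measure.volumeIoiPow n).map (Subtype.val : Ioi (0 : ℝ) → ℝ) =
      (volume.restrict (Ioi (0 : ℝ))).withDensity fun r => ENNReal.ofReal (r ^ n) := by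
  ext s hs
  rw [Measure.map_apply measurable_subtype_coe hs, Measure.volumeIoiPow,
    withDensity_apply _ (measurable_subtype_coe hs), withDensity_apply _ hs,
    setLIntegral_subtype measurableSet_Ioi _ fun r : ℝ => ENNReal.ofReal (r ^ n),
    Subtype.image_preimage_coe, Measure.restrict_restrict hs, inter_comm]

/-- The norm is the radial component of the polar decomposition, so this is its second marginal. -/
theorem map_norm_addHaar {F : Type*} [NormedAddCommGroup F] [NormedSpace ℝ F]
    [FiniteDimensional ℝ F] [Nontrivial F] [MeasurableSpace F] [BorelSpace F]
    (μ : Measure F) [μ.IsAddHaarMeasure] :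
    μ.map norm = μ.toSphere univ • (volume.restrict (Ioi (0 : ℝ))).withDensity
      fun r => ENNReal.ofReal (r ^ (Module.finrank ℝ F - 1)) := by
  have h1 : (μ.comap (Subtype.val : ({0}ᶜ : Set F) → F)).map Subtype.val = μ := by
    rw [map_comap_subtype_coe (measurableSet_singleton _).compl, restrict_compl_singleton]
  have h2 : (norm ∘ Subtype.val : ({0}ᶜ : Set F) → ℝ) =
      (Subtype.val ∘ Prod.snd) ∘ homeomorphUnitSphereProd F := by
    funext x
    simp
  have hm : Measurable (homeomorphUnitSphereProd F) := (homeomorphUnitSphereProd F).measurable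
  conv_lhs => rw [← h1]
  rw [Measure.map_map measurable_norm measurable_subtype_coe, h2,
    ← Measure.map_map (measurable_subtype_coe.comp measurable_snd) hm,
    μ.measurePreserving_homeomorphUnitSphereProd.map_eq,
    ← Measure.map_map measurable_subtype_coe measurable_snd, Measure.map_snd_prod,
    Measure.map_smul, map_val_volumeIoiPow]

theorem integral_prod_norm {F : Type*} [NormedAddCommGroup F] [NormedSpace ℝ F]
    [FiniteDimensional ℝ F] [Nontrivial F] [MeasurableSpace F] [BorelSpace F]
    (μ : Measure F) [μ.IsAddHaarMeasure] {G : ℝ × ℝ → ℂ} (hG : Measurable G) :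
    ∫ p : ℝ × F, G (p.1, ‖p.2‖) ∂(volume.prod μ) =
      μ.toSphere.real univ * ∫ p in univ ×ˢ Ioi (0 : ℝ),
        ((p.2 ^ (Module.finrank ℝ F - 1) : ℝ) : ℂ) * G p := by
  have h1 : ∫ p : ℝ × F, G (p.1, ‖p.2‖) ∂(volume.prod μ) =
      ∫ p, G p ∂((volume : Measure ℝ).prod (μ.map norm)) := by
    have h := Measure.map_prod_map (volume : Measure ℝ) μ measurable_id measurable_norm
    rw [Measure.map_id] at h
    rw [h, integral_map (by fun_prop) hG.aestronglyMeasurable]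
    rfl
  have hd : Measurable fun r : ℝ => ENNReal.ofReal (r ^ (Module.finrank ℝ F - 1)) := by fun_prop
  rw [h1, map_norm_addHaar, Measure.prod_smul_right, integral_smul_measure,
    prod_withDensity_right hd, ← Measure.restrict_univ (μ := (volume : Measure ℝ)),
    Measure.prod_restrict]
  have e : (fun z : ℝ × ℝ => ENNReal.ofReal (z.2 ^ (Module.finrank ℝ F - 1))) =
      fun z => ((Real.toNNReal (z.2 ^ (Module.finrank ℝ F - 1)) : NNReal) : ENNReal) := rfl
  rw [e, integral_withDensity_eq_integral_smul (by fun_prop), Measure.restrict_univ,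
    ← Measure.volume_eq_prod, Complex.real_smul]
  congr 1
  refine setIntegral_congr_fun (MeasurableSet.univ.prod measurableSet_Ioi) fun p hp => ?_
  simp only [NNReal.smul_def]
  rw [Real.coe_toNNReal _ (pow_nonneg (le_of_lt hp.2) _), Complex.real_smul]

/-- The half-plane is the range of angles `(0, π)`; the extra power of `r` is the Jacobian. -/
theorem integral_halfPlane_polar (n : ℕ) (f g : ℝ → ℂ) :
    ∫ p in univ ×ˢ Ioi (0 : ℝ), ((p.2 ^ n : ℝ) : ℂ) *
        (f (p.1 / √(p.1 ^ 2 + p.2 ^ 2)) * g (√(p.1 ^ 2 + p.2 ^ 2))) =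
      (∫ r in Ioi (0 : ℝ), (r : ℂ) ^ (n + 1) * g r) *
        ∫ θ in Ioo 0 Real.pi, ((Real.sin θ : ℝ) : ℂ) ^ n * f (Real.cos θ) := by
  rw [← integral_indicator (MeasurableSet.univ.prod measurableSet_Ioi),
    ← integral_comp_polarCoord_symm]
  have hθ : ∫ θ in Ioo 0 Real.pi, ((Real.sin θ : ℝ) : ℂ) ^ n * f (Real.cos θ) =
      ∫ θ in Ioo (-Real.pi) Real.pi, (Ioo 0 Real.pi).indicator
        (fun θ => ((Real.sin θ : ℝ) : ℂ) ^ n * f (Real.cos θ)) θ := by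
    rw [setIntegral_indicator measurableSet_Ioo, inter_eq_self_of_subset_right]
    exact Ioo_subset_Ioo (by linarith [Real.pi_pos]) le_rfl
  rw [hθ, ← setIntegral_prod_mul, ← Measure.volume_eq_prod]
  refine setIntegral_congr_fun polarCoord.open_target.measurableSet fun p hp => ?_
  have hp1 : 0 < p.1 := hp.1
  have hp2 : p.2 ∈ Ioo (-Real.pi) Real.pi := hp.2
  simp only [polarCoord_symm_apply]
  by_cases h : p.2 ∈ Ioo 0 Real.pi
  · have hs : 0 < Real.sin p.2 := Real.sin_pos_of_mem_Ioo h
    have hr : √((p.1 * Real.cos p.2) ^ 2 + (p.1 * Real.sin p.2) ^ 2) = p.1 := by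
      rw [mul_pow, mul_pow, ← mul_add, Real.cos_sq_add_sin_sq, mul_one, Real.sqrt_sq hp1.le]
    rw [indicator_of_mem h, indicator_of_mem (by
      exact ⟨mem_univ _, mul_pos hp1 hs⟩)]
    simp only [hr]
    rw [mul_div_cancel_left₀ _ hp1.ne', Complex.real_smul]
    push_cast
    ring
  · have hs : Real.sin p.2 ≤ 0 := by
      have : p.2 ≤ 0 := by
        by_contra h0
        exact h ⟨by linarith, hp2.2⟩
      exact Real.sin_nonpos_of_nonpos_of_neg_pi_le this hp2.1.le
    rw [indicator_of_notMem h, indicator_of_notMem, smul_zero, mul_zero]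
    rintro ⟨-, h0⟩
    have h0' : 0 < p.1 * Real.sin p.2 := h0
    nlinarith

theorem integral_euclidean_last {m : ℕ} (G : ℝ × ℝ → ℂ) :
    ∫ y : E (m + 1), G (y (Fin.last m), √(‖y‖ ^ 2 - (y (Fin.last m)) ^ 2)) =
      ∫ p : ℝ × E m, G (p.1, ‖p.2‖) := by
  let Φ : E (m + 1) ≃ᵐ ℝ × E m := (MeasurableEquiv.toLp 2 (Fin (m + 1) → ℝ)).symm.trans
    ((MeasurableEquiv.piFinSuccAbove (fun _ => ℝ) (Fin.last m)).trans
      ((MeasurableEquiv.refl ℝ).prodCongr (MeasurableEquiv.toLp 2 (Fin m → ℝ))))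
  have hΦ : MeasurePreserving Φ := by
    exact ((MeasurePreserving.id volume).prod (PiLp.volume_preserving_toLp (Fin m))).comp
      ((volume_preserving_piFinSuccAbove (fun _ => ℝ) (Fin.last m)).comp
        (PiLp.volume_preserving_ofLp (Fin (m + 1))))
  rw [← hΦ.integral_comp' (g := fun p : ℝ × E m => G (p.1, ‖p.2‖))]
  refine integral_congr_ae (Filter.Eventually.of_forall fun y => ?_)
  have h1 : (Φ y).1 = y (Fin.last m) := rfl
  have h2 : ‖y‖ ^ 2 - (y (Fin.last m)) ^ 2 = ‖(Φ y).2‖ ^ 2 := by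
    have h3 : ∀ i : Fin m, (Φ y).2 i = y i.castSucc := fun i => by
      change y ((Fin.last m).succAbove i) = _
      rw [Fin.succAbove_last]
    rw [EuclideanSpace.real_norm_sq_eq, EuclideanSpace.real_norm_sq_eq, Fin.sum_univ_castSucc]
    simp [h3]
  simp only
  rw [h1, h2, Real.sqrt_sq (norm_nonneg _)]

/-- The case `a = 0` of `integral_sphere_last_cpow`. -/
theorem toSphere_real_univ {m : ℕ} (hm : 1 ≤ m) :
    (((volume : Measure (E m)).toSphere.real univ : ℝ) : ℂ) =
      2 * (Real.pi : ℂ) ^ ((m : ℂ) / 2) / Complex.Gamma (m / 2) := by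
  obtain ⟨d, rfl⟩ : ∃ d, m = d + 1 := ⟨m - 1, by omega⟩
  have h := integral_sphere_last_cpow (m := d) (a := 0) (by simp)
  simp only [Complex.cpow_zero, integral_const, Complex.real_smul, mul_one, zero_add,
    Complex.Gamma_one_half_eq] at h
  rw [h, mul_assoc, ← Complex.cpow_add _ _ (by exact_mod_cast Real.pi_pos.ne')]
  push_cast
  ring_nf

/-- A Gaussian radial factor turns the sphere integral into one over the whole space. After a
rotation of `e` to the last axis the integrand depends on `yₙ` and the distance to that axis only;
polar coordinates in this half-plane bring out the same Gaussian factor, which is cancelled.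
Measurability of `f` suffices. -/
theorem integral_sphere_zonal {m : ℕ} (hm : 1 ≤ m) {e : E (m + 1)} (he : ‖e‖ = 1) {f : ℝ → ℂ}
    (hf : Measurable f) :
    ∫ w : Metric.sphere (0 : E (m + 1)) 1, f ⟪w.1, e⟫_ℝ
        ∂(volume : Measure (E (m + 1))).toSphere =
      2 * (Real.pi : ℂ) ^ ((m : ℂ) / 2) / Complex.Gamma (m / 2) *
        ∫ θ in Ioo 0 Real.pi, ((Real.sin θ : ℝ) : ℂ) ^ (m - 1) * f (Real.cos θ) := by
  -- Makes `E m` nontrivial, as the polar decomposition of that factor requires.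
  have : Nonempty (Fin m) := ⟨⟨0, hm⟩⟩
  set g : ℝ → ℂ := fun r => Complex.exp (-(r : ℂ) ^ 2) with hg
  have hA := integral_polar (volume : Measure (E (m + 1)))
    (fun y => f (⟪y, e⟫_ℝ / ‖y‖) * g ‖y‖)
    (fun w : Metric.sphere (0 : E (m + 1)) 1 => f ⟪w.1, e⟫_ℝ) g (fun r w hr => by
      have hw : ‖w.1‖ = 1 := by simp
      simp only [real_inner_smul_left, norm_smul, hw, mul_one, Real.norm_eq_abs, abs_of_pos hr]
      rw [mul_div_cancel_left₀ _ hr.ne'])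
  -- The reflection in the hyperplane orthogonal to the difference of two unit vectors exchanges
  -- them.
  obtain ⟨T, hT⟩ : ∃ T : E (m + 1) ≃ₗᵢ[ℝ] E (m + 1),
      T (EuclideanSpace.single (Fin.last m) 1) = e :=
    ⟨_, Submodule.reflection_sub (by simp [he])⟩
  have hB : ∫ y : E (m + 1), f (⟪y, e⟫_ℝ / ‖y‖) * g ‖y‖ =
      ∫ y : E (m + 1), f (y (Fin.last m) / ‖y‖) * g ‖y‖ := by
    rw [← T.measurePreserving.integral_comp T.toHomeomorph.measurableEmbedding]
    refine integral_congr_ae (Filter.Eventually.of_forall fun y => ?_)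
    simp only [← hT, LinearIsometryEquiv.inner_map_map, LinearIsometryEquiv.norm_map]
    congr 3
    simp [EuclideanSpace.inner_single_right]
  have hC := integral_euclidean_last (m := m)
    fun p => f (p.1 / √(p.1 ^ 2 + p.2 ^ 2)) * g (√(p.1 ^ 2 + p.2 ^ 2))
  have hC' : ∀ y : E (m + 1), (y (Fin.last m)) ^ 2 + √(‖y‖ ^ 2 - (y (Fin.last m)) ^ 2) ^ 2 =
      ‖y‖ ^ 2 := fun y => by
    rw [Real.sq_sqrt, add_sub_cancel]
    rw [EuclideanSpace.real_norm_sq_eq, Fin.sum_univ_castSucc, add_sub_cancel_right]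
    positivity
  simp only [hC', Real.sqrt_sq (norm_nonneg _)] at hC
  have hD := integral_prod_norm (volume : Measure (E m))
    (G := fun p => f (p.1 / √(p.1 ^ 2 + p.2 ^ 2)) * g (√(p.1 ^ 2 + p.2 ^ 2))) (by
      have : Measurable g := by fun_prop
      fun_prop)
  simp only [← Measure.volume_eq_prod] at hD
  rw [hD, integral_halfPlane_polar] at hC
  rw [hB, hC, toSphere_real_univ hm] at hA
  simp only [finrank_euclideanSpace, Fintype.card_fin, Nat.add_sub_cancel,
    Nat.sub_add_cancel hm] at hA
  have hR : ∫ r in Ioi (0 : ℝ), (r : ℂ) ^ m * g r = Complex.Gamma ((m + 1) / 2) / 2 := by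
    rw [← integral_cpow_mul_exp_neg_sq (s := m + 1) (by simp; positivity)]
    simp [hg]
  have hR0 : Complex.Gamma (((m : ℂ) + 1) / 2) / 2 ≠ 0 := by
    refine div_ne_zero (Complex.Gamma_ne_zero_of_re_pos ?_) two_ne_zero
    rw [Complex.div_ofNat_re]
    simp
    positivity
  rw [hR] at hA
  apply mul_right_cancel₀ hR0
  rw [← hA]
  ring

/-- The substitution `x = (1 - cos θ) / 2`, for which `x (1 - x) = (sin θ / 2)²`, gives a Beta
integral. -/
theorem integral_sin_pow_mul_cpow {m : ℕ} (hm : 1 ≤ m) {b : ℂ} (hb : 0 < ((m : ℂ) / 2 - b).re) :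
    ∫ θ in Ioo 0 Real.pi, ((Real.sin θ : ℝ) : ℂ) ^ (m - 1) *
        ((1 - Real.cos θ : ℝ) : ℂ) ^ (-b) =
      2 ^ ((m : ℂ) - 1 - b) * (Complex.Gamma ((m : ℂ) / 2 - b) * Complex.Gamma ((m : ℂ) / 2) /
        Complex.Gamma ((m : ℂ) - b)) := by
  have hm' : 0 < ((m : ℂ) / 2).re := by
    rw [Complex.div_ofNat_re]
    simp
    omega
  have hB := Complex.betaIntegral_eq_Gamma_mul_div _ _ hb hm'
  rw [show (m : ℂ) / 2 - b + m / 2 = m - b by ring] at hB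
  rw [← hB, Complex.betaIntegral, intervalIntegral.integral_of_le zero_le_one,
    integral_Ioc_eq_integral_Ioo]
  have himg : (fun θ : ℝ => (1 - Real.cos θ) / 2) '' Ioo 0 Real.pi = Ioo 0 1 := by
    ext y
    constructor
    · rintro ⟨θ, hθ, rfl⟩
      have h1 := Real.cos_lt_cos_of_nonneg_of_le_pi le_rfl hθ.2.le hθ.1
      have h2 := Real.cos_lt_cos_of_nonneg_of_le_pi hθ.1.le le_rfl hθ.2
      rw [Real.cos_zero] at h1
      rw [Real.cos_pi] at h2
      constructor <;> simp only <;> linarith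
    · intro hy
      refine ⟨Real.arccos (1 - 2 * y), ⟨Real.arccos_pos.mpr (by linarith [hy.1]), ?_⟩, ?_⟩
      · refine lt_of_le_of_ne (Real.arccos_le_pi _) fun h => ?_
        rw [Real.arccos_eq_pi] at h
        linarith [hy.2]
      · simp only
        rw [Real.cos_arccos (by linarith [hy.2]) (by linarith [hy.1])]
        ring
  have hinj : InjOn (fun θ : ℝ => (1 - Real.cos θ) / 2) (Ioo 0 Real.pi) := by
    intro s hs t ht hst
    refine Real.injOn_cos ⟨hs.1.le, hs.2.le⟩ ⟨ht.1.le, ht.2.le⟩ ?_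
    simp only at hst
    linarith
  have hder : ∀ θ ∈ Ioo 0 Real.pi, HasDerivWithinAt (fun θ : ℝ => (1 - Real.cos θ) / 2)
      (Real.sin θ / 2) (Ioo 0 Real.pi) θ := by
    intro θ _
    have := ((Real.hasDerivAt_cos θ).const_sub 1).div_const 2
    rw [neg_neg] at this
    exact this.hasDerivWithinAt
  rw [← himg, integral_image_eq_integral_abs_deriv_smul measurableSet_Ioo hder hinj,
    ← integral_const_mul]
  refine setIntegral_congr_fun measurableSet_Ioo fun θ hθ => ?_
  have hs : 0 < Real.sin θ := Real.sin_pos_of_mem_Ioo hθ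
  have h1 := Real.cos_lt_cos_of_nonneg_of_le_pi le_rfl hθ.2.le hθ.1
  have h2 := Real.cos_lt_cos_of_nonneg_of_le_pi hθ.1.le le_rfl hθ.2
  rw [Real.cos_zero] at h1
  rw [Real.cos_pi] at h2
  set x : ℝ := (1 - Real.cos θ) / 2 with hx
  have hx0 : 0 < x := by rw [hx]; linarith
  have hx1 : 0 < 1 - x := by rw [hx]; linarith
  have hprod : x * (1 - x) = (Real.sin θ / 2) * (Real.sin θ / 2) := by
    rw [hx]
    linear_combination (-1 / 4) * Real.sin_sq_add_cos_sq θ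
  set S : ℝ := Real.sin θ / 2 with hS
  have hS0 : 0 < S := by positivity
  have hS0' : (S : ℂ) ≠ 0 := by exact_mod_cast hS0.ne'
  have e1 : (x : ℂ) ^ ((m : ℂ) / 2 - b - 1) * (1 - (x : ℂ)) ^ ((m : ℂ) / 2 - 1) =
      (x : ℂ) ^ (-b) * (S : ℂ) ^ ((m : ℂ) - 2) := by
    rw [show (m : ℂ) / 2 - b - 1 = -b + (m / 2 - 1) by ring, ← ofReal_cpow_mul_cpow hx0,
      mul_assoc, show (1 - (x : ℂ)) = ((1 - x : ℝ) : ℂ) by push_cast; ring,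
      ← Complex.mul_cpow_ofReal_nonneg hx0.le hx1.le, ← Complex.ofReal_mul, hprod,
      Complex.ofReal_mul, Complex.mul_cpow_ofReal_nonneg hS0.le hS0.le,
      ofReal_cpow_mul_cpow hS0]
    ring_nf
  have e2 : ((1 - Real.cos θ : ℝ) : ℂ) ^ (-b) = 2 ^ (-b) * (x : ℂ) ^ (-b) := by
    have := Complex.mul_cpow_ofReal_nonneg (a := 2) (b := x) zero_le_two hx0.le (-b)
    rw [← Complex.ofReal_mul, show 2 * x = 1 - Real.cos θ by rw [hx]; ring] at this
    simpa using this
  have e3 : ((Real.sin θ : ℝ) : ℂ) ^ (m - 1) = 2 ^ ((m : ℂ) - 1) * (S : ℂ) ^ ((m : ℂ) - 1) := by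
    have hm1 : (m : ℂ) - 1 = ((m - 1 : ℕ) : ℂ) := by push_cast [hm]; rfl
    rw [show Real.sin θ = 2 * S by rw [hS]; ring, hm1,
      Complex.cpow_natCast, Complex.cpow_natCast, ← mul_pow]
    push_cast
    rfl
  have e4 : (S : ℂ) ^ ((m : ℂ) - 1) = S * (S : ℂ) ^ ((m : ℂ) - 2) := by
    rw [show (m : ℂ) - 1 = 1 + (m - 2) by ring, Complex.cpow_add _ _ hS0', Complex.cpow_one]
  rw [Complex.real_smul, abs_of_pos hS0, e1, e2, e3, e4,
    show (m : ℂ) - 1 - b = (m - 1) + -b by ring, Complex.cpow_add _ _ two_ne_zero]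
  ring

theorem integral_sphere_one_sub_inner_cpow {m : ℕ} (hm : 1 ≤ m) {e : E (m + 1)} (he : ‖e‖ = 1)
    {b : ℂ} (hb : 0 < ((m : ℂ) / 2 - b).re) :
    ∫ w : Metric.sphere (0 : E (m + 1)) 1, ((1 - ⟪w.1, e⟫_ℝ : ℝ) : ℂ) ^ (-b)
        ∂(volume : Measure (E (m + 1))).toSphere =
      2 * (Real.pi : ℂ) ^ ((m : ℂ) / 2) / Complex.Gamma (m / 2) *
        (2 ^ ((m : ℂ) - 1 - b) * (Complex.Gamma ((m : ℂ) / 2 - b) *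
          Complex.Gamma ((m : ℂ) / 2) / Complex.Gamma ((m : ℂ) - b))) := by
  rw [integral_sphere_zonal hm he (f := fun t => ((1 - t : ℝ) : ℂ) ^ (-b)) (by fun_prop),
    integral_sin_pow_mul_cpow hm hb]

/-- For the real exponent `Re b` the closed form is nonzero, while a non-integrable function would
have integral `0`; this forces integrability. The complex power is dominated by the real one. -/
theorem integrable_sphere_one_sub_inner_cpow {m : ℕ} (hm : 1 ≤ m) {e : E (m + 1)}
    (he : ‖e‖ = 1) {b : ℂ} (hb : 0 < ((m : ℂ) / 2 - b).re) :
    Integrable (fun w : Metric.sphere (0 : E (m + 1)) 1 => ((1 - ⟪w.1, e⟫_ℝ : ℝ) : ℂ) ^ (-b))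
      (volume : Measure (E (m + 1))).toSphere := by
  have hm' : 0 < ((m : ℂ) / 2).re := by
    rw [Complex.div_ofNat_re]
    simp
    omega
  have hb' : 0 < ((m : ℂ) / 2 - (b.re : ℂ)).re := by simpa using hb
  have h := integral_sphere_one_sub_inner_cpow hm he hb'
  have hint : Integrable
      (fun w : Metric.sphere (0 : E (m + 1)) 1 => ((1 - ⟪w.1, e⟫_ℝ : ℝ) : ℂ) ^ (-(b.re : ℂ)))
      (volume : Measure (E (m + 1))).toSphere := by
    by_contra hc
    rw [integral_undef hc] at h
    have h1 := Complex.Gamma_ne_zero_of_re_pos hm'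
    have h2 := Complex.Gamma_ne_zero_of_re_pos hb'
    have h3 : Complex.Gamma ((m : ℂ) - (b.re : ℂ)) ≠ 0 := by
      apply Complex.Gamma_ne_zero_of_re_pos
      rw [show (m : ℂ) - (b.re : ℂ) = (m / 2 - (b.re : ℂ)) + m / 2 by ring, Complex.add_re]
      exact add_pos hb' hm'
    have h4 : (Real.pi : ℂ) ≠ 0 := by exact_mod_cast Real.pi_pos.ne'
    refine absurd h.symm ?_
    simp [h1, h2, h3, h4, Complex.cpow_eq_zero_iff]
  refine hint.mono (by
    have : Measurable fun w : Metric.sphere (0 : E (m + 1)) 1 =>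
      ((1 - ⟪w.1, e⟫_ℝ : ℝ) : ℂ) ^ (-b) := by fun_prop
    exact this.aestronglyMeasurable) (Filter.Eventually.of_forall fun w => ?_)
  have hle : ⟪w.1, e⟫_ℝ ≤ 1 := by
    have := real_inner_le_norm w.1 e
    simpa [he] using this
  rcases hle.lt_or_eq with hlt | heq
  · have h0 : 0 < 1 - ⟪w.1, e⟫_ℝ := by linarith
    rw [Complex.norm_cpow_eq_rpow_re_of_pos h0, Complex.norm_cpow_eq_rpow_re_of_pos h0]
    simp
  -- At `w = e` the convention `0 ^ z = 0` for `z ≠ 0` decides the comparison, with `b = 0` apart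
  -- because `0 ^ 0 = 1`.
  · rw [heq, sub_self, Complex.ofReal_zero]
    by_cases hb0 : b = 0
    · simp [hb0]
    · rw [Complex.zero_cpow (neg_ne_zero.mpr hb0), norm_zero]
      exact norm_nonneg _

/-- The zonal formula is applied to the indicator of `1 ≤ |t|`, which vanishes at `cos θ` for `0 < θ
< π`. At the excluded points `w = ±e` the formula for the derivative in `s` is not available. -/
theorem ae_abs_inner_lt_one {m : ℕ} (hm : 1 ≤ m) {e : E (m + 1)} (he : ‖e‖ = 1) :
    ∀ᵐ w ∂(volume : Measure (E (m + 1))).toSphere, |⟪w.1, e⟫_ℝ| < 1 := by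
  set f : ℝ → ℂ := {t : ℝ | 1 ≤ |t|}.indicator 1 with hf
  have hs : MeasurableSet {t : ℝ | 1 ≤ |t|} := measurableSet_le measurable_const (by fun_prop)
  have h := integral_sphere_zonal hm he (f := f) (measurable_one.indicator hs)
  have h0 : ∫ θ in Ioo 0 Real.pi, ((Real.sin θ : ℝ) : ℂ) ^ (m - 1) * f (Real.cos θ) = 0 := by
    rw [setIntegral_congr_fun (g := fun _ => 0) measurableSet_Ioo]
    · simp
    · intro θ hθ
      have h1 := Real.cos_lt_cos_of_nonneg_of_le_pi le_rfl hθ.2.le hθ.1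
      have h2 := Real.cos_lt_cos_of_nonneg_of_le_pi hθ.1.le le_rfl hθ.2
      rw [Real.cos_zero] at h1
      rw [Real.cos_pi] at h2
      simp only
      rw [hf, indicator_of_notMem, mul_zero]
      simpa using abs_lt.mpr ⟨h2, h1⟩
  rw [h0, mul_zero] at h
  have hmeas : MeasurableSet {w : Metric.sphere (0 : E (m + 1)) 1 | 1 ≤ |⟪w.1, e⟫_ℝ|} :=
    measurableSet_le measurable_const (by fun_prop)
  have h1 : ∀ w : Metric.sphere (0 : E (m + 1)) 1, f ⟪w.1, e⟫_ℝ =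
      {w : Metric.sphere (0 : E (m + 1)) 1 | 1 ≤ |⟪w.1, e⟫_ℝ|}.indicator (fun _ => (1 : ℂ)) w := by
    intro w
    simp [hf, indicator_apply]
  simp only [h1] at h
  rw [integral_indicator hmeas, setIntegral_const, Complex.real_smul, mul_one] at h
  have h2 := (measureReal_eq_zero_iff).mp (show (volume : Measure (E (m + 1))).toSphere.real
    {w : Metric.sphere (0 : E (m + 1)) 1 | 1 ≤ |⟪w.1, e⟫_ℝ|} = 0 by exact_mod_cast h)
  rw [ae_iff]
  simpa using h2

/-! ### The singular operators on the spherical vector -/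

theorem inner_slice_slice_zero {d : ℕ} (x y : E d) (s : ℝ) :
    ⟪slice x s, slice y 0⟫_ℝ = ⟪x, y⟫_ℝ := by
  simp only [PiLp.inner_apply, slice]
  rw [Fin.sum_univ_castSucc]
  simp

/-- The direction of a point of the cone. -/
def coneDirection {m : ℕ} (η : Cone m) : E (m + 1) := η.1.2⁻¹ • η.1.1

theorem norm_coneDirection {m : ℕ} (η : Cone m) : ‖coneDirection η‖ = 1 := by
  have h1 : ‖coneDirection η‖ ^ 2 = 1 := by
    have h0 : η.1.2 ≠ 0 := η.2.2
    rw [coneDirection, norm_smul, mul_pow, η.2.1, Real.norm_eq_abs, sq_abs]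
    field_simp
  exact (pow_eq_one_iff_of_nonneg (norm_nonneg _) two_ne_zero).mp h1

theorem extend_sphericalVector {m : ℕ} (lam : ℂ) (w : Metric.sphere (0 : E m) 1) {s : ℝ}
    (hs : s ^ 2 < 1) :
    extend (n := m) (sphericalVector m lam).1 (slice (√(1 - s ^ 2) • w.1) s, 1) = 1 := by
  have hw : ‖w.1‖ = 1 := by simp
  have h : ‖slice (√(1 - s ^ 2) • w.1) s‖ ^ 2 = (1 : ℝ) ^ 2 ∧ (1 : ℝ) ≠ 0 := by
    refine ⟨?_, one_ne_zero⟩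
    rw [norm_slice_sq, norm_smul, hw, mul_one, Real.norm_eq_abs, sq_abs,
      Real.sq_sqrt (by linarith)]
    ring
  rw [extend, dif_pos h]
  simp [sphericalVector]

theorem abs_lorentz_slice {m : ℕ} (η : Cone m) (w : E (m + 1)) {a s : ℝ}
    (h : a * ⟪w, coneDirection η⟫_ℝ < 1) :
    |lorentz (slice (a • w) s, 1) (slice η.1.1 0, η.1.2)| / 2 =
      |η.1.2| / 2 * (1 - a * ⟪w, coneDirection η⟫_ℝ) := by
  have h0 : η.1.2 ≠ 0 := η.2.2
  have h1 : lorentz (slice (a • w) s, 1) (slice η.1.1 0, η.1.2) =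
      -(η.1.2 * (1 - a * ⟪w, coneDirection η⟫_ℝ)) := by
    simp only [lorentz, coneDirection]
    rw [inner_slice_slice_zero, real_inner_smul_left, real_inner_smul_right]
    field_simp
    ring
  rw [h1, abs_neg, abs_mul, abs_of_pos (show 0 < 1 - a * ⟪w, coneDirection η⟫_ℝ by linarith)]
  ring

theorem iteratedDeriv_kernelB {m : ℕ} (k : ℕ) (lam nu : ℂ) (η : Cone m)
    (w : Metric.sphere (0 : E (m + 1)) 1) (hw : |⟪w.1, coneDirection η⟫_ℝ| < 1) :
    iteratedDeriv (2 * k) (fun s : ℝ =>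
        (((1 - s ^ 2) ^ (((m : ℝ) - 1) / 2) : ℝ) : ℂ) *
        ((|lorentz (slice (√(1 - s ^ 2) • w.1) s, 1) (slice η.1.1 0, η.1.2)| / 2 : ℝ) : ℂ) ^ (-nu) *
        extend (sphericalVector (m + 1) lam).1 (slice (√(1 - s ^ 2) • w.1) s, 1)) 0 =
      ((|η.1.2| / 2 : ℝ) : ℂ) ^ (-nu) * (((2 * k).factorial / k.factorial : ℂ) *
        zonalFun nu ⟪w.1, coneDirection η⟫_ℝ (radialCoeff nu ((m : ℂ) / 2 - 1 / 2) k)) := by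
  set τ := ⟪w.1, coneDirection η⟫_ℝ with hτ
  rw [← iteratedDeriv_zonal nu hw, ← iteratedDeriv_const_mul_field]
  apply Filter.EventuallyEq.iteratedDeriv_eq
  have hnear : ∀ᶠ s : ℝ in 𝓝 0, s ^ 2 < 1 := by
    have : ContinuousAt (fun s : ℝ => s ^ 2) 0 := by fun_prop
    exact this.eventually (gt_mem_nhds (by simp))
  filter_upwards [hnear] with s hs
  have h1 : 0 < 1 - s ^ 2 := by linarith
  have h2 : √(1 - s ^ 2) ≤ 1 := by
    rw [Real.sqrt_le_one]
    nlinarith [sq_nonneg s]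
  have h3 : √(1 - s ^ 2) * τ < 1 := by
    calc √(1 - s ^ 2) * τ ≤ √(1 - s ^ 2) * |τ| :=
          mul_le_mul_of_nonneg_left (le_abs_self τ) (Real.sqrt_nonneg _)
      _ ≤ 1 * |τ| := mul_le_mul_of_nonneg_right h2 (abs_nonneg τ)
      _ < 1 := by rwa [one_mul]
  rw [extend_sphericalVector lam w hs, abs_lorentz_slice η w.1 h3, ← hτ, mul_one,
    Complex.ofReal_mul, Complex.mul_cpow_ofReal_nonneg (by positivity) (by linarith),
    Complex.ofReal_cpow h1.le]
  push_cast
  rw [show ((m : ℂ) - 1) / 2 = m / 2 - 1 / 2 by ring]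
  ring

/-- The sphere integral is a functional on coefficients whose moments are known, with `μ = m / 2`;
the sphere area cancels the remaining `Γ(m / 2)`. -/
theorem integral_zonalFun_radialCoeff {m : ℕ} (hm : 1 ≤ m) {e : E (m + 1)} (he : ‖e‖ = 1)
    (k : ℕ) {nu : ℂ} (hnu : 0 < ((m : ℂ) / 2 - nu - k).re) :
    ∫ w : Metric.sphere (0 : E (m + 1)) 1,
        zonalFun nu ⟪w.1, e⟫_ℝ (radialCoeff nu ((m : ℂ) / 2 - 1 / 2) k)
        ∂(volume : Measure (E (m + 1))).toSphere =
      (-1) ^ k * 2 ^ ((m : ℂ) - 2 * k - nu) * (Real.pi : ℂ) ^ ((m : ℂ) / 2) *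
        Complex.Gamma ((m : ℂ) / 2 - nu - k) / Complex.Gamma ((m : ℂ) - 2 * k - nu) := by
  have hm' : 0 < ((m : ℂ) / 2).re := by
    rw [Complex.div_ofNat_re]
    simp
    omega
  have hre : ∀ i : ℕ, i ≤ k → 0 < ((m : ℂ) / 2 - (nu + i)).re := by
    intro i hi
    have : (i : ℝ) ≤ k := by exact_mod_cast hi
    simp at hnu ⊢
    linarith
  set I : (ℕ →₀ ℂ) →ₗ[ℂ] ℂ := Finsupp.linearCombination ℂ fun i : ℕ =>
    ∫ w : Metric.sphere (0 : E (m + 1)) 1, ((1 - ⟪w.1, e⟫_ℝ : ℝ) : ℂ) ^ (-(nu + i))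
      ∂(volume : Measure (E (m + 1))).toSphere with hI
  have h1 : ∀ p ∈ Finsupp.supported ℂ ℂ (Iic k),
      ∫ w : Metric.sphere (0 : E (m + 1)) 1, zonalFun nu ⟪w.1, e⟫_ℝ p
        ∂(volume : Measure (E (m + 1))).toSphere = I p := by
    intro p hp
    simp only [zonalFun, hI, Finsupp.linearCombination_apply, Finsupp.sum, smul_eq_mul]
    rw [integral_finsetSum _ fun i hi =>
      (integrable_sphere_one_sub_inner_cpow hm he (hre i (hp hi))).const_mul _]
    exact Finset.sum_congr rfl fun i _ => integral_const_mul _ _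
  rw [h1 _ (radialCoeff_mem nu _ k), functional_radialCoeff nu
    (V := 2 * (Real.pi : ℂ) ^ ((m : ℂ) / 2) / Complex.Gamma (m / 2)) hm' hnu (fun i hi => by
      rw [hI, Finsupp.linearCombination_single, one_smul,
        integral_sphere_one_sub_inner_cpow hm he (hre i hi),
        show 2 * ((m : ℂ) / 2) = m by ring]
      ring) k le_rfl, show 2 * ((m : ℂ) / 2) = m by ring,
    Complex.cpow_sub _ 1 two_ne_zero, Complex.cpow_one]
  have hG := Complex.Gamma_ne_zero_of_re_pos hm'
  field_simp

theorem factorial_two_mul_div_factorial (k : ℕ) :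
    ((2 * k).factorial / k.factorial : ℂ) = 2 ^ k * (Nat.doubleFactorial (2 * k - 1) : ℂ) := by
  have h0 : (k.factorial : ℂ) ≠ 0 := by exact_mod_cast k.factorial_ne_zero
  rw [div_eq_iff h0]
  rcases k with _ | k
  -- For `k = 0` the truncated `2 * k - 1` is `0`, and `0‼ = 1` agrees with the convention `(-1)!! =
  -- 1`.
  · simp
  · have h := Nat.factorial_eq_mul_doubleFactorial (2 * k + 1)
    rw [show 2 * k + 1 + 1 = 2 * (k + 1) by ring, Nat.doubleFactorial_two_mul] at h
    rw [show 2 * (k + 1) - 1 = 2 * k + 1 by omega, h]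
    push_cast
    ring

theorem pairingB_spherical {m k : ℕ} (hm : 1 ≤ m) {lam nu : ℂ} (hl : lam + nu = m - 2 * k)
    (hre : 0 < (lam - nu).re) (η : Cone m) :
    pairingB k lam nu (sphericalVector (m + 1) lam) η =
      (-1) ^ k * 2 ^ k * (Real.pi : ℂ) ^ ((m : ℂ) / 2) *
        (Nat.doubleFactorial (2 * k - 1) : ℂ) / Complex.Gamma lam *
          (sphericalVector m nu).1 η := by
  have hlam : (m : ℂ) - 2 * k - nu = lam := by rw [← hl]; ring
  have hδ : (lam - nu) / 2 = (m : ℂ) / 2 - nu - k := by rw [← hlam]; ring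
  have hδre : 0 < ((m : ℂ) / 2 - nu - k).re := by
    rw [← hδ, Complex.div_ofNat_re]
    positivity
  have he := norm_coneDirection η
  rw [pairingB, integral_congr_ae (g := fun w : Metric.sphere (0 : E (m + 1)) 1 =>
    ((|η.1.2| / 2 : ℝ) : ℂ) ^ (-nu) * (((2 * k).factorial / k.factorial : ℂ) *
        zonalFun nu ⟪w.1, coneDirection η⟫_ℝ (radialCoeff nu ((m : ℂ) / 2 - 1 / 2) k))) (by
    filter_upwards [ae_abs_inner_lt_one hm he] with w hw
    exact iteratedDeriv_kernelB k lam nu η w hw),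
    integral_const_mul, integral_const_mul, integral_zonalFun_radialCoeff hm he k hδre, hlam, hδ,
    factorial_two_mul_div_factorial]
  have hG := Complex.Gamma_ne_zero_of_re_pos hδre
  have h1 : (sphericalVector m nu).1 η = 2 ^ (-nu) * ((|η.1.2| / 2 : ℝ) : ℂ) ^ (-nu) := by
    have := Complex.mul_cpow_ofReal_nonneg (a := 2) (b := |η.1.2| / 2) zero_le_two
      (by positivity) (-nu)
    rw [← Complex.ofReal_mul, mul_div_cancel₀ _ two_ne_zero] at this
    simpa [sphericalVector] using this
  -- Here `λ + ν = m - 2k` makes all powers of two from the delta normalization, the measure and the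
  -- sphere integral cancel.
  have h2 : (2 : ℂ) ^ (2 * k + 1) * 2 ^ lam = 2 ^ (m + 1) * 2 ^ (-nu) := by
    rw [← Complex.cpow_natCast, ← Complex.cpow_natCast, ← Complex.cpow_add _ _ two_ne_zero,
      ← Complex.cpow_add _ _ two_ne_zero]
    congr 1
    push_cast
    linear_combination hl
  rw [h1]
  have h3 : (2 : ℂ) ^ (m + 1) ≠ 0 := pow_ne_zero _ two_ne_zero
  simp only [div_eq_mul_inv (_ * _) (Complex.Gamma lam)]
  generalize Complex.Gamma ((m : ℂ) / 2 - nu - k) = G at hG ⊢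
  generalize (Complex.Gamma lam)⁻¹ = L
  generalize ((|η.1.2| / 2 : ℝ) : ℂ) ^ (-nu) = c
  rw [div_mul_eq_mul_div, div_eq_iff (mul_ne_zero h3 hG)]
  linear_combination (c * (2 ^ k * (Nat.doubleFactorial (2 * k - 1) : ℂ)) * ((-1) ^ k *
    (Real.pi : ℂ) ^ ((m : ℂ) / 2) * G * L)) * h2

theorem isFamilyB_spherical {m : ℕ} (hm : 1 ≤ m) (k : ℕ) (lam : ℂ) :
    IsFamilyB (m := m) k (sphericalVector (m + 1) lam) fun lam' nu' =>
      ((-1) ^ k * 2 ^ k * (Real.pi : ℂ) ^ ((m : ℂ) / 2) *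
        (Nat.doubleFactorial (2 * k - 1) : ℂ) / Complex.Gamma lam') • sphericalVector m nu' := by
  constructor
  · intro η
    have h1 : Differentiable ℂ fun z : ℂ => (m - 2 * k - z : ℂ) := by fun_prop
    have h2 := (differentiable_sphericalVector_apply η).comp h1
    exact (Complex.differentiable_one_div_Gamma.const_mul _).mul h2
  · intro lam' nu' hl hre η
    rw [transport_sphericalVector, pairingB_spherical hm hl hre]
    rfl

theorem opB_spherical {m : ℕ} (hm : 1 ≤ m) (lam nu : ℂ) (k : ℕ)
    (hk : (k : ℂ) = (m - lam - nu) / 2) :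
    opB m k lam nu (sphericalVector (m + 1) lam) =
      ((-1) ^ k * 2 ^ k * (Real.pi : ℂ) ^ ((m : ℂ) / 2) *
        (Nat.doubleFactorial (2 * k - 1) : ℂ) / Complex.Gamma lam) • sphericalVector m nu :=
  (isFamilyB_spherical hm k lam).opB_eq (by rw [hk]; ring)

end SymmetryBreaking

end

/-! ### The three formulas, with `n - 1 = m` -/

open SymmetryBreaking in
theorem theorem1p10 (n m : ℕ) (hn : 2 ≤ n) (hm : n = m + 1) :
    (∀ lam nu : ℂ,
      opA m lam nu (sphericalVector (m + 1) lam) =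
        ((Real.pi : ℂ) ^ (((n : ℂ) - 1) / 2) / Complex.Gamma lam) • sphericalVector m nu) ∧
    (∀ (lam nu : ℂ) (k : ℕ), (k : ℂ) = ((n : ℂ) - 1 - lam - nu) / 2 →
      opB m k lam nu (sphericalVector (m + 1) lam) =
        ((-1) ^ k * 2 ^ k * (Real.pi : ℂ) ^ (((n : ℂ) - 1) / 2) *
          (Nat.doubleFactorial (2 * k - 1) : ℂ) / Complex.Gamma lam) • sphericalVector m nu) ∧
    (∀ (lam nu : ℂ) (l : ℕ), (l : ℂ) = (nu - lam) / 2 →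
      opC m l lam nu (sphericalVector (m + 1) lam) =
        ((-1) ^ l * 2 ^ (2 * l) * (ascPochhammer ℂ (2 * l)).eval lam / (Nat.factorial l : ℂ)) •
          sphericalVector m nu) := by
  have h1 : 1 ≤ m := by omega
  have h2 : (n : ℂ) - 1 = m := by rw [hm]; push_cast; ring
  rw [h2]
  exact ⟨opA_spherical h1, opB_spherical h1, fun lam nu l => opC_spherical h1 lam nu⟩
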